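/- For $\tau$ in the upper half-plane $\mathbb{H}$, $y=\operatorname{Im}\tau$, and $u,v\in\mathbb{C}\setminus(\mathbb{Z}\tau+\mathbb{Z})$ let $$\theta(v;\tau)=\sum_{\nu\in\frac12+\mathbb{Z}}e^{\pi i\nu^2\tau+2\pi i\nu(v+\frac12)},\qquad \mu(u,v;\tau)=\frac{e^{\pi iu}}{\theta(v;\tau)}\sum_{n\in\mathbb{Z}}\frac{(-1)^ne^{\pi i(n^2+n)\tau+2\pi inv}}{1-e^{2\pi in\tau+2\pi iu}},$$ and, for $u\in\mathbb{C}$, let $$R(u;\tau)=\sum_{\nu\in\frac12+\mathbb{Z}}\Bigl(\operatorname{sgn}(\nu)-E\bigl((\nu+\tfrac{\operatorname{Im}u}{y})\sqrt{2y}\bigr)\Bigr)(-1)^{\nu-\frac12}e^{-\pi i\nu^2\tau-2\pi i\nu u},\qquad E(x)=2\int_0^xe^{-\pi t^2}\,dt.$$ Let $\widetilde\mu(u,v;\tau)=\mu(u,v;\tau)+\frac i2R(u-v;\tau)$ be Zwegers' completed $\mu$-function and put $h_1(\tau)=\widetilde\mu(\tfrac12,\tfrac12;\tau)$. Let $\eta$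 be the Dedekind eta function and let $\nu_\eta$ be the eta multiplier, $$\nu_\eta\begin{pmatrix}a&b\\c&d\end{pmatrix}=\frac{1}{\sqrt{c\tau+d}}\,\frac{\eta\left(\frac{a\tau+b}{c\tau+d}\right)}{\eta(\tau)}$$ (which does not depend on $\tau$), where roots are principal. Let $k\in\mathbb{Z}$, let $\Gamma\le\mathrm{SL}_2(\mathbb{Z})$ be a congruence subgroup and let $\nu$ be a multiplier system of weight $\frac k2$ on $\Gamma$; that is, $|\nu|=1$ on $\Gamma$, the function $\nu(\gamma)(c\tau+d)^{k/2}$ is a factor of automorphy for $\gamma=\begin{pmatrix}a&b\\c&d\end{pmatrix}\in\Gamma$, and this factor equals $1$ at $-I$ if $-I\in\Gamma$. A harmonic weak Maass form of weight $\frac k2$ on $\Gamma$ with multiplier system $\nu$ is a smooth function $f:\mathbb{H}\to\mathbb{C}$ such that 1. $f\left(\frac{a\tau+b}{c\tau+d}\right)=\nu(\gamma)(c\tau+d)^{k/2}f(\tau)$ for all $\gamma=\begin{pmatrix}a&b\\c&d\end{pmatrix}\in\Gamma$ and $\tau\in\mathbb{H}$; 2. $\Delta_{k/2}f=0$, where,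 with $\tau=x+iy$, $\Delta_{k/2}=-y^2\left(\frac{\partial^2}{\partial x^2}+\frac{\partial^2}{\partial y^2}\right)+\frac{iky}{2}\left(\frac{\partial}{\partial x}+i\frac{\partial}{\partial y}\right)$; 3. $f$ has at most linear exponential growth at the cusps: for every $\begin{pmatrix}a&b\\c&d\end{pmatrix}\in\mathrm{SL}_2(\mathbb{Z})$ there is a constant $C$ such that $(c\tau+d)^{-k/2}f\left(\frac{a\tau+b}{c\tau+d}\right)=O(e^{Cy})$ as $y\to\infty$, uniformly in $x$. Then $h_1$ is a harmonic weak Maass form of weight $\frac12$ on $\Gamma_0(2)$ with multiplier system $\nu_\eta^{-3}$. -/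

import Mathlib

open scoped MatrixGroups ContDiff

noncomputable section

namespace HarmonicMaass

/-! ### Harmonic weak Maass forms with a multiplier system -/

/-- The linear form `cτ + d` attached to `γ = (a b; c d)`. -/
def lin (γ : SL(2, ℤ)) (τ : UpperHalfPlane) : ℂ :=
  ((γ 1 0 : ℤ) : ℂ) * (τ : ℂ) + ((γ 1 1 : ℤ) : ℂ)

/-- The factor `(cτ + d)^{k/2}` (principal branch). -/
def autFactor (k : ℤ) (γ : SL(2, ℤ)) (τ : UpperHalfPlane) : ℂ :=
  lin γ τ ^ ((k : ℂ) / 2)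

/-- `ν` is a multiplier system of weight `k/2` on `Γ`: it has absolute value one,
`ν(γ) (cτ + d)^{k/2}` is a factor of automorphy, and this factor is trivial at `-I`
if `-I ∈ Γ`. -/
structure IsMultiplierSystem (k : ℤ) (Γ : Subgroup SL(2, ℤ)) (ν : SL(2, ℤ) → ℂ) : Prop where
  norm_eq_one : ∀ γ ∈ Γ, ‖ν γ‖ = 1
  cocycle : ∀ γ ∈ Γ, ∀ δ ∈ Γ, ∀ τ : UpperHalfPlane,
    ν (γ * δ) * autFactor k (γ * δ) τ =
      (ν γ * autFactor k γ (δ • τ)) * (ν δ * autFactor k δ τ)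
  neg_one : (-1 : SL(2, ℤ)) ∈ Γ → ∀ τ : UpperHalfPlane, ν (-1) * autFactor k (-1) τ = 1

/-- The partial derivative in the direction of `x`, where `z = x + iy`. -/
def partialX (F : ℂ → ℂ) (z : ℂ) : ℂ := fderiv ℝ F z 1

/-- The partial derivative in the direction of `y`, where `z = x + iy`. -/
def partialY (F : ℂ → ℂ) (z : ℂ) : ℂ := fderiv ℝ F z Complex.I

/-- The weight `k/2` hyperbolic Laplacian
`-y² (∂²/∂x² + ∂²/∂y²) + (i k y / 2) (∂/∂x + i ∂/∂y)`
applied to a function `F` of `z = x + iy`. -/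
def laplacianAux (k : ℤ) (F : ℂ → ℂ) (z : ℂ) : ℂ :=
  -((z.im : ℂ) ^ 2) * (partialX (partialX F) z + partialY (partialY F) z)
    + Complex.I * (k : ℂ) * (z.im : ℂ) / 2 * (partialX F z + Complex.I * partialY F z)

/-- The weight `k/2` hyperbolic Laplacian of a function on the upper half-plane. -/
def hypLaplacian (k : ℤ) (f : UpperHalfPlane → ℂ) (τ : UpperHalfPlane) : ℂ :=
  laplacianAux k (fun z => f (UpperHalfPlane.ofComplex z)) (τ : ℂ)

/-- At most linear exponential growth at all cusps: for every `M = (a b; c d)` in `SL₂(ℤ)`,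
`(cτ + d)^{-k/2} f(Mτ) = O(e^{C Im τ})` as `Im τ → ∞`, uniformly in `Re τ`, for some `C`. -/
def HasLinearExpGrowthAtCusps (k : ℤ) (f : UpperHalfPlane → ℂ) : Prop :=
  ∀ M : SL(2, ℤ), ∃ C : ℝ,
    (fun τ : UpperHalfPlane => (autFactor k M τ)⁻¹ * f (M • τ))
      =O[UpperHalfPlane.atImInfty] fun τ : UpperHalfPlane => Real.exp (C * τ.im)

/-- `f` is a harmonic weak Maass form of weight `k/2` on the congruence subgroup `Γ` with
multiplier system `ν`. -/
structure IsHarmonicWeakMaassForm (k : ℤ) (Γ : Subgroup SL(2, ℤ)) (ν : SL(2, ℤ) → ℂ)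
    (f : UpperHalfPlane → ℂ) : Prop where
  congruence : CongruenceSubgroup.IsCongruenceSubgroup Γ
  multiplier : IsMultiplierSystem k Γ ν
  transform : ∀ γ ∈ Γ, ∀ τ : UpperHalfPlane, f (γ • τ) = ν γ * autFactor k γ τ * f τ
  smooth : ContDiffOn ℝ ∞ (fun z : ℂ => f (UpperHalfPlane.ofComplex z)) {z : ℂ | 0 < z.im}
  harmonic : ∀ τ : UpperHalfPlane, hypLaplacian k f τ = 0
  growth : HasLinearExpGrowthAtCusps k f

/-! ### The eta multiplier -/

/-- `η(γτ) / (√(cτ + d) η(τ))`; this does not depend on `τ`, see `etaMultiplier_eq`. -/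
def etaQuotient (γ : SL(2, ℤ)) (τ : UpperHalfPlane) : ℂ :=
  1 / lin γ τ ^ (1 / 2 : ℂ) *
    (ModularForm.eta ((γ • τ : UpperHalfPlane) : ℂ) / ModularForm.eta (τ : ℂ))

/-- The eta multiplier `ν_η`, the constant value of `etaQuotient γ`. -/
def etaMultiplier (γ : SL(2, ℤ)) : ℂ := etaQuotient γ UpperHalfPlane.I

lemma lin_eq_denom (γ : SL(2, ℤ)) (τ : UpperHalfPlane) :
    lin γ τ = UpperHalfPlane.denom (γ : GL (Fin 2) ℝ) τ := by
  simp [lin, UpperHalfPlane.denom]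

lemma lin_ne_zero (γ : SL(2, ℤ)) (τ : UpperHalfPlane) : lin γ τ ≠ 0 := by
  rw [lin_eq_denom]; exact UpperHalfPlane.denom_ne_zero _ _

lemma etaQuotient_pow (γ : SL(2, ℤ)) (τ : UpperHalfPlane) : etaQuotient γ τ ^ 24 = 1 := by
  have hΔ : ModularForm.eta ((γ • τ : UpperHalfPlane) : ℂ) ^ 24 =
      lin γ τ ^ 12 * ModularForm.eta (τ : ℂ) ^ 24 := by
    have h := SlashInvariantForm.slash_action_eqn'' CuspForm.discriminant
      (γ := (γ : GL (Fin 2) ℝ)) (MonoidHom.mem_range.2 ⟨γ, rfl⟩) τ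
    rw [lin_eq_denom]
    exact h
  have h1 : (lin γ τ ^ (1 / 2 : ℂ)) ^ 24 = lin γ τ ^ 12 := by
    rw [← Complex.cpow_nat_mul]
    norm_num
  have h2 := pow_ne_zero 12 (lin_ne_zero γ τ)
  have h3 := pow_ne_zero 24 (ModularForm.eta_ne_zero (z := (τ : ℂ)) τ.2)
  rw [etaQuotient, mul_pow, div_pow, div_pow, h1, hΔ, one_pow, mul_div_assoc, div_self h3, mul_one,
    one_div, inv_mul_cancel₀ h2]

lemma continuous_etaQuotient (γ : SL(2, ℤ)) : Continuous (etaQuotient γ) := by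
  have he : Continuous fun τ : UpperHalfPlane => ModularForm.eta (τ : ℂ) := by
    refine continuous_iff_continuousAt.2 fun τ => ?_
    exact (ModularForm.differentiableAt_eta_of_mem_upperHalfPlaneSet τ.2).continuousAt.comp
      UpperHalfPlane.continuous_coe.continuousAt
  have hl : Continuous (lin γ) := by
    unfold lin
    exact (continuous_const.mul UpperHalfPlane.continuous_coe).add continuous_const
  have hs : Continuous fun τ : UpperHalfPlane => lin γ τ ^ (1 / 2 : ℂ) := by
    by_cases hc : γ 1 0 = 0
    · simp only [lin, hc, Int.cast_zero, zero_mul, zero_add]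
      exact continuous_const
    · refine hl.cpow continuous_const fun τ => Or.inr ?_
      have : (lin γ τ).im = (γ 1 0 : ℝ) * τ.im := by simp [lin]
      rw [this]
      exact mul_ne_zero (by exact_mod_cast hc) τ.im_pos.ne'
  unfold etaQuotient
  refine (continuous_const.div hs fun τ => ?_).mul
    ((he.comp (continuous_const_smul (γ : GL (Fin 2) ℝ))).div he fun τ => ModularForm.eta_ne_zero τ.2)
  rw [Ne, Complex.cpow_eq_zero_iff]
  exact fun h => lin_ne_zero γ τ h.1

/-- The quotient defining the eta multiplier is independent of `τ`. -/
lemma etaMultiplier_eq (γ : SL(2, ℤ)) (τ : UpperHalfPlane) :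
    etaQuotient γ τ = etaMultiplier γ := by
  have hfin : {z : ℂ | z ^ 24 = 1}.Finite := by
    have := (Polynomial.nthRoots 24 (1 : ℂ)).toFinset.finite_toSet
    refine this.subset fun z hz => ?_
    simpa [Polynomial.mem_nthRoots] using hz
  exact isPreconnected_univ.constant_of_mapsTo hfin.isDiscrete
    (continuous_etaQuotient γ).continuousOn (fun τ _ => etaQuotient_pow γ τ)
    (Set.mem_univ _) (Set.mem_univ _)

/-! ### Zwegers' functions -/

/-- The Jacobi theta function
`θ(v;τ) = ∑_{ν ∈ 1/2 + ℤ} e^{π i ν² τ + 2 π i ν (v + 1/2)}`, with `ν = n + 1/2`. -/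
def theta (v : ℂ) (τ : UpperHalfPlane) : ℂ :=
  ∑' n : ℤ, Complex.exp (Real.pi * Complex.I * ((n : ℂ) + 1 / 2) ^ 2 * (τ : ℂ)
    + 2 * Real.pi * Complex.I * ((n : ℂ) + 1 / 2) * (v + 1 / 2))

/-- Zwegers' function `μ(u,v;τ)`, for `u, v ∉ ℤτ + ℤ`. -/
def mu (u v : ℂ) (τ : UpperHalfPlane) : ℂ :=
  Complex.exp (Real.pi * Complex.I * u) / theta v τ *
    ∑' n : ℤ, (-1 : ℂ) ^ n *
      Complex.exp (Real.pi * Complex.I * ((n : ℂ) ^ 2 + n) * (τ : ℂ)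
        + 2 * Real.pi * Complex.I * n * v) /
      (1 - Complex.exp (2 * Real.pi * Complex.I * n * (τ : ℂ) + 2 * Real.pi * Complex.I * u))

/-- `E(x) = 2 ∫₀ˣ e^{-π t²} dt`. -/
def errE (x : ℝ) : ℝ := 2 * ∫ t in (0 : ℝ)..x, Real.exp (-Real.pi * t ^ 2)

/-- Zwegers' non-holomorphic correction term
`R(u;τ) = ∑_{ν ∈ 1/2 + ℤ} (sgn ν - E((ν + Im u / y) √(2y))) (-1)^{ν - 1/2}
  e^{-π i ν² τ - 2 π i ν u}`, where `y = Im τ`, with `ν = n + 1/2`. -/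
def R (u : ℂ) (τ : UpperHalfPlane) : ℂ :=
  ∑' n : ℤ,
    ((Real.sign ((n : ℝ) + 1 / 2)
      - errE (((n : ℝ) + 1 / 2 + u.im / τ.im) * Real.sqrt (2 * τ.im)) : ℝ) : ℂ) *
    (-1 : ℂ) ^ n *
    Complex.exp (-Real.pi * Complex.I * ((n : ℂ) + 1 / 2) ^ 2 * (τ : ℂ)
      - 2 * Real.pi * Complex.I * ((n : ℂ) + 1 / 2) * u)

/-- Zwegers' completed function `μ̃(u,v;τ) = μ(u,v;τ) + (i/2) R(u - v;τ)`. -/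
def muTilde (u v : ℂ) (τ : UpperHalfPlane) : ℂ :=
  mu u v τ + Complex.I / 2 * R (u - v) τ

/-- `h₁(τ) = μ̃(1/2,1/2;τ)`. -/
def h1 (τ : UpperHalfPlane) : ℂ := muTilde (1 / 2) (1 / 2) τ

end HarmonicMaass

end

/-!
The proof rests on an expression of `h₁` as a quotient of two functions whose behaviour under
`SL₂(ℤ)` is evident: if `y = Im τ`, then
`h₁(τ) = (i / 2π) L(τ) / θ(1/2; τ)`, where
`L(τ) = ∑ ψ(ω) e^{-π|ω + 1/2|² / (2y)} / (ω + 1/2)` runs over the lattice points `ω = mτ + n` and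
`ψ(ω)` is a fourth root of unity (`h1_eq`).

To obtain it, multiply `R(0; τ)` by the theta function and collect the products of terms with
indices `ν` and `a = ν + n` into rows with fixed `n`; the exponent `(a² - ν²) / 2` of `q` becomes
`n² / 2 + nν`. In a row the factors `(-1)^{ν - 1/2} q^{nν}` form a geometric progression. Summation
by parts therefore splits off `2 q^{n(n+1)/2} / (1 + q^n)`, which is twice a term of the Lerch sum
of `μ(1/2, 1/2)`, and turns `sgn ν - E(ν √(2y))` into differences of values of `E`, that is, into
integrals of Gaussians (`one_add_exp_mul_tsum_row`). Poisson summation under the integral sign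
converts what is left into the `n`-th row of `L` (`tsum_row_eq`).

More generally there are a lattice sum `latticeSum a b` and a theta function `thetaChar a b` for
every characteristic `(a, b)`. The generators `S` and `T` permute these families, in weights `1`
and `1/2`, and translating `(a, b)` by an integral vector multiplies both by the same factor. Hence
`L / θ · η³` belongs to a family of weight two that is permuted by `SL₂(ℤ)`, and `Γ₀(2)` fixes the
class of `(0, 1/2)` modulo `ℤ²` (`h1_smul_of_mem_Gamma0`). At any cusp one of the three
characteristics of order two appears; there the lattice sum grows at most linearly in `y`, and the
theta function has a non-zero leading term (`hasLinearExpGrowthAtCusps_h1`). The theta functions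
have no zeros, because the eighth power of the product of the three of them is a cusp form of
weight `12`, hence a multiple of the discriminant (`thetaProd_ne_zero`).

For smoothness and harmonicity one works with the series itself. The derivatives of
`∑ ν^{2k} (sgn ν - E(ν √(2y))) (-1)^{ν - 1/2} e^{-πiν²τ}` are multiples of the series for `k + 1`,
plus, in the direction of `y`, the product of `y^{-1/2}` and an antiholomorphic theta series
(`hasFDerivAt_errSum`). By induction all these series are smooth, and the Laplace equation reduces
to differentiating this product (`hypLaplacian_h1`).
-/

noncomputable section

namespace HarmonicMaass

open Complex Filter Topology
open scoped Real ModularForm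

/-! ### The eta multiplier -/

lemma lin_mul (γ δ : SL(2, ℤ)) (τ : UpperHalfPlane) :
    lin (γ * δ) τ = lin γ (δ • τ) * lin δ τ := by
  have h : ((δ • τ : UpperHalfPlane) : ℂ) =
      ((δ 0 0 : ℤ) * (τ : ℂ) + (δ 0 1 : ℤ)) / lin δ τ := by
    rw [UpperHalfPlane.coe_specialLinearGroup_apply]
    simp [lin]
  have h0 := lin_ne_zero δ τ
  rw [lin, lin, h]
  field_simp
  simp only [lin, Matrix.SpecialLinearGroup.coe_mul, Matrix.mul_apply, Fin.sum_univ_two]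
  push_cast
  ring

lemma autFactor_one_sq (γ : SL(2, ℤ)) (τ : UpperHalfPlane) : autFactor 1 γ τ ^ 2 = lin γ τ := by
  rw [autFactor, ← Complex.cpow_nat_mul]
  norm_num

lemma autFactor_one_ne_zero (γ : SL(2, ℤ)) (τ : UpperHalfPlane) : autFactor 1 γ τ ≠ 0 := fun h =>
  lin_ne_zero γ τ (by rw [← autFactor_one_sq, h]; norm_num)

lemma eta_coe_ne_zero (τ : UpperHalfPlane) : ModularForm.eta (τ : ℂ) ≠ 0 :=
  ModularForm.eta_ne_zero τ.2

lemma etaMultiplier_pow (γ : SL(2, ℤ)) : etaMultiplier γ ^ 24 = 1 :=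
  etaQuotient_pow γ _

lemma etaMultiplier_ne_zero (γ : SL(2, ℤ)) : etaMultiplier γ ≠ 0 := fun h => by
  simpa [h] using etaMultiplier_pow γ

lemma norm_etaMultiplier (γ : SL(2, ℤ)) : ‖etaMultiplier γ‖ = 1 :=
  Complex.norm_eq_one_of_pow_eq_one (etaMultiplier_pow γ) (by norm_num)

lemma eta_smul (γ : SL(2, ℤ)) (τ : UpperHalfPlane) :
    ModularForm.eta ((γ • τ : UpperHalfPlane) : ℂ) =
      etaMultiplier γ * autFactor 1 γ τ * ModularForm.eta (τ : ℂ) := by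
  have h : lin γ τ ^ (1 / 2 : ℂ) = autFactor 1 γ τ := by rw [autFactor]; norm_num
  have h1 := autFactor_one_ne_zero γ τ
  have h2 := eta_coe_ne_zero τ
  rw [← etaMultiplier_eq γ τ, etaQuotient, h]
  field_simp

/-- The factor of automorphy of weight `1/2` attached to `ν_η⁻³` is the weight two factor
`(cτ + d)²` divided by that of `η³`. -/
lemma etaMultiplier_mul_autFactor (γ : SL(2, ℤ)) (τ : UpperHalfPlane) :
    etaMultiplier γ ^ (-3 : ℤ) * autFactor 1 γ τ = lin γ τ ^ 2 *
      (ModularForm.eta (τ : ℂ) / ModularForm.eta ((γ • τ : UpperHalfPlane) : ℂ)) ^ 3 := by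
  have h1 := autFactor_one_ne_zero γ τ
  have h2 := eta_coe_ne_zero τ
  have h3 := etaMultiplier_ne_zero γ
  rw [eta_smul, ← autFactor_one_sq, zpow_neg]
  norm_cast
  field_simp

lemma isMultiplierSystem_etaMultiplier (Γ : Subgroup SL(2, ℤ)) :
    IsMultiplierSystem 1 Γ fun γ => etaMultiplier γ ^ (-3 : ℤ) where
  norm_eq_one γ _ := by rw [norm_zpow, norm_etaMultiplier, one_zpow]
  cocycle γ _ δ _ τ := by
    have h1 := eta_coe_ne_zero τ
    have h2 := eta_coe_ne_zero (δ • τ)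
    have h3 := eta_coe_ne_zero (γ • δ • τ)
    rw [etaMultiplier_mul_autFactor, etaMultiplier_mul_autFactor, etaMultiplier_mul_autFactor,
      lin_mul, mul_smul]
    field_simp
  neg_one _ τ := by
    have h1 := eta_coe_ne_zero τ
    have h2 : (-1 : SL(2, ℤ)) • τ = τ := by
      rw [ModularGroup.SL_neg_smul, one_smul]
    have h3 : lin (-1) τ = -1 := by simp [lin]
    rw [etaMultiplier_mul_autFactor, h2, h3, div_self h1]
    norm_num

lemma coe_S_smul (τ : UpperHalfPlane) :
    ((ModularGroup.S • τ : UpperHalfPlane) : ℂ) = -1 / (τ : ℂ) := by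
  rw [UpperHalfPlane.modular_S_smul, UpperHalfPlane.coe_mk, inv_neg, neg_div, one_div]

lemma coe_T_smul (τ : UpperHalfPlane) :
    ((ModularGroup.T • τ : UpperHalfPlane) : ℂ) = (τ : ℂ) + 1 := by
  rw [UpperHalfPlane.modular_T_smul, UpperHalfPlane.coe_vadd, add_comm, Complex.ofReal_one]

lemma eta_S_smul (τ : UpperHalfPlane) :
    ModularForm.eta ((ModularGroup.S • τ : UpperHalfPlane) : ℂ) =
      (-I * (τ : ℂ)) ^ (1 / 2 : ℂ) * ModularForm.eta (τ : ℂ) := by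
  have hI : (Complex.I : ℂ) ^ (1 / 2 : ℂ) ≠ 0 := by simp [Complex.cpow_eq_zero_iff]
  have hτ : (τ : ℂ) = I * (-I * τ) := by rw [← mul_assoc]; simp
  have hmul : (τ : ℂ) ^ (1 / 2 : ℂ) = I ^ (1 / 2 : ℂ) * (-I * τ) ^ (1 / 2 : ℂ) := by
    have hre : 0 < (-I * (τ : ℂ)).re := by simpa using τ.im_pos
    have h0 : -I * (τ : ℂ) ≠ 0 := fun h => by simp [h] at hre
    have harg := abs_lt.1 (Complex.abs_arg_lt_pi_div_two_iff.2 (Or.inl hre))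
    conv_lhs => rw [hτ]
    rw [Complex.cpow_def_of_ne_zero (mul_ne_zero I_ne_zero h0),
      Complex.cpow_def_of_ne_zero I_ne_zero,
      Complex.cpow_def_of_ne_zero h0, Complex.log_mul I_ne_zero h0, add_mul, Complex.exp_add]
    rw [Complex.arg_I]
    constructor <;> linarith [harg.1, harg.2]
  have h := ModularForm.eta_comp_eq_csqrt_I_inv τ.2
  simp only [Function.comp, Pi.smul_apply, Pi.mul_apply, smul_eq_mul, Complex.sqrt,
    ← one_div (2 : ℂ)] at h
  rw [coe_S_smul, h, hmul]
  field_simp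

lemma eta_T_smul_pow_three (τ : UpperHalfPlane) :
    ModularForm.eta ((ModularGroup.T • τ : UpperHalfPlane) : ℂ) ^ 3 =
      cexp (π * I / 4) * ModularForm.eta (τ : ℂ) ^ 3 := by
  have h : ∀ n : ℕ, ModularForm.eta_q n ((τ : ℂ) + 1) = ModularForm.eta_q n τ := fun n => by
    rw [ModularForm.eta_q_eq_pow, ModularForm.eta_q_eq_pow, mul_add, mul_one, Complex.exp_add,
      Complex.exp_two_pi_mul_I, mul_one]
  rw [coe_T_smul, ModularForm.eta, ModularForm.eta]
  simp only [h, mul_pow, ← mul_assoc, Function.Periodic.qParam, ← Complex.exp_nat_mul,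
    ← Complex.exp_add]
  congr 2
  push_cast
  ring

/-! ### Theta functions with characteristics -/

lemma exp_pi_mul_I_mul_int (k : ℤ) : cexp (π * I * k) = (-1) ^ k := by
  rw [mul_comm, Complex.exp_int_mul, Complex.exp_pi_mul_I]

/-- The theta function with real characteristics `(a, b)`: up to an exponential factor it is the
value of `θ(·; z)` at the point `a z + b`, and this factor is chosen so that `S` and `T` permute the
family up to automorphy factors which do not depend on `(a, b)`. -/
def thetaChar (a b : ℝ) (z : ℂ) : ℂ :=
  cexp (π * I * (a + 1 / 2) ^ 2 * z + π * I * (b + 1 / 2) + π * I * a * b) *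
    jacobiTheta₂ ((a + 1 / 2) * z + b + 1 / 2) z

lemma thetaChar_eq_tsum (a b : ℝ) (z : ℂ) :
    thetaChar a b z = cexp (π * I * a * b) * ∑' n : ℤ,
      cexp (π * I * (n + 1 / 2 + a) ^ 2 * z + 2 * π * I * (n + 1 / 2) * (b + 1 / 2)) := by
  rw [thetaChar, jacobiTheta₂, ← tsum_mul_left, ← tsum_mul_left]
  refine tsum_congr fun n => ?_
  rw [jacobiTheta₂_term, ← Complex.exp_add, ← Complex.exp_add]
  congr 1
  ring

lemma theta_half_eq (τ : UpperHalfPlane) : theta (1 / 2) τ = thetaChar 0 (1 / 2) τ := by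
  rw [thetaChar_eq_tsum, theta]
  simp

lemma differentiableAt_thetaChar (a b : ℝ) {z : ℂ} (hz : 0 < z.im) :
    DifferentiableAt ℂ (thetaChar a b) z := by
  have h : DifferentiableAt ℂ (fun z : ℂ => jacobiTheta₂ ((a + 1 / 2) * z + b + 1 / 2) z) z := by
    have h1 := (hasFDerivAt_jacobiTheta₂ ((a + 1 / 2) * z + b + 1 / 2) hz).differentiableAt
    exact h1.comp (f := fun z : ℂ => (((a + 1 / 2) * z + b + 1 / 2 : ℂ), z)) z (by fun_prop)
  unfold thetaChar
  exact DifferentiableAt.mul (by fun_prop) h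

lemma thetaChar_S_smul (a b : ℝ) (τ : UpperHalfPlane) :
    thetaChar a b (ModularGroup.S • τ : UpperHalfPlane) =
      -I * (-I * (τ : ℂ)) ^ (1 / 2 : ℂ) * thetaChar b (-a) τ := by
  have hτ : (τ : ℂ) ≠ 0 := UpperHalfPlane.ne_zero τ
  have hc : (-I * (τ : ℂ)) ^ (1 / 2 : ℂ) ≠ 0 := by
    simp [Complex.cpow_eq_zero_iff, hτ]
  have h := jacobiTheta₂_functional_equation (((b : ℂ) + 1 / 2) * τ + (-a : ℝ) + 1 / 2 - 1) τ
  have h1 := jacobiTheta₂_add_left (((b : ℂ) + 1 / 2) * τ + (-a : ℝ) + 1 / 2 - 1) τ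
  rw [sub_add_cancel] at h1
  rw [← h1] at h
  rw [coe_S_smul, thetaChar, thetaChar, h]
  have e1 : (((b : ℂ) + 1 / 2) * τ + (-a : ℝ) + 1 / 2 - 1) / τ =
      ((a : ℂ) + 1 / 2) * (-1 / τ) + b + 1 / 2 := by
    push_cast
    field_simp
    ring
  have hI : (-I : ℂ) = cexp (-(π * I / 2)) := by
    rw [Complex.exp_neg, mul_div_right_comm, Complex.exp_pi_div_two_mul_I, Complex.inv_I]
  have key : cexp (π * I * (a + 1 / 2) ^ 2 * (-1 / τ) + π * I * (b + 1 / 2) + π * I * a * b) =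
      -I * (cexp (π * I * (b + 1 / 2) ^ 2 * τ + π * I * ((-a : ℝ) + 1 / 2) + π * I * b * (-a : ℝ)) *
        cexp (-π * I * ((b + 1 / 2) * τ + (-a : ℝ) + 1 / 2 - 1) ^ 2 / τ)) := by
    rw [hI, ← Complex.exp_add, ← Complex.exp_add]
    congr 1
    push_cast
    field_simp
    ring
  rw [e1, key]
  field_simp

lemma thetaChar_T_smul (a b : ℝ) (τ : UpperHalfPlane) :
    thetaChar a b (ModularGroup.T • τ : UpperHalfPlane) =
      cexp (π * I / 4) * thetaChar a (a + b) τ := by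
  rw [coe_T_smul, thetaChar_eq_tsum, thetaChar_eq_tsum]
  simp only [← tsum_mul_left, ← Complex.exp_add]
  refine tsum_congr fun n => ?_
  obtain ⟨l, hl⟩ := Int.even_mul_succ_self n
  have hl' : (n : ℂ) * (n + 1) = l + l := by exact_mod_cast hl
  refine Complex.exp_eq_exp_iff_exists_int.2 ⟨l, ?_⟩
  push_cast
  linear_combination (π * I) * hl'

lemma thetaChar_add_int (a b : ℝ) (m n : ℤ) (z : ℂ) :
    thetaChar (a + m) (b + n) z =
      (-1) ^ (m * n + m + n) * cexp (π * I * (n * a - m * b)) * thetaChar a b z := by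
  rw [thetaChar_eq_tsum, thetaChar_eq_tsum, ← exp_pi_mul_I_mul_int,
    ← (Equiv.subRight m).tsum_eq]
  simp only [← tsum_mul_left, ← Complex.exp_add, Equiv.subRight_apply]
  refine tsum_congr fun j => ?_
  refine Complex.exp_eq_exp_iff_exists_int.2 ⟨j * n - m * n - m, ?_⟩
  push_cast
  ring

/-- A theta series with non-negative exponents tends at `i∞` to the sum of its terms with exponent
zero. -/
lemma tendsto_tsum_mul_exp {u : ℤ → ℂ} (hu : ∀ n, ‖u n‖ ≤ 1) {e : ℤ → ℤ} (he : ∀ n, 0 ≤ e n)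
    (he' : ∀ n, |n| ≤ e n + 1) :
    Tendsto (fun τ : UpperHalfPlane => ∑' n, u n * cexp (π * I * e n * τ))
      UpperHalfPlane.atImInfty (𝓝 (∑' n, if e n = 0 then u n else 0)) := by
  have hs : Summable fun n : ℤ => Real.exp (1 - |(n : ℝ)|) := by
    have h : Summable fun n : ℕ => Real.exp (1 - |((n : ℤ) : ℝ)|) := by
      simpa [sub_eq_add_neg, Real.exp_add] using Real.summable_exp_neg_nat.mul_left (Real.exp 1)
    refine Summable.of_nat_of_neg h ?_
    simpa using h
  refine tendsto_tsum_of_dominated_convergence hs (fun n => ?_) ?_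
  · split_ifs with h
    · simp [h]
    · refine squeeze_zero_norm' (a := fun τ : UpperHalfPlane => Real.exp (-τ.im))
        (Eventually.of_forall fun τ => ?_)
        (Real.tendsto_exp_neg_atTop_nhds_zero.comp tendsto_comap)
      have h1 : (1 : ℝ) ≤ e n := by exact_mod_cast lt_of_le_of_ne (he n) (Ne.symm h)
      rw [norm_mul, Complex.norm_exp]
      have h4 : (π * I * e n * τ : ℂ).re = -(π * e n * τ.im) := by simp
      rw [h4]
      refine (mul_le_of_le_one_left (Real.exp_pos _).le (hu n)).trans (Real.exp_le_exp.2 ?_)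
      have : 1 ≤ π * e n := by nlinarith [Real.pi_gt_three]
      nlinarith [τ.im_pos]
  · filter_upwards [(UpperHalfPlane.atImInfty_mem _).2 ⟨1, fun τ h => h⟩] with τ hτ n
    have h1 : (0 : ℝ) ≤ e n := by exact_mod_cast he n
    have h2 : |(n : ℝ)| ≤ e n + 1 := by exact_mod_cast he' n
    have h3 : 1 ≤ τ.im := hτ
    rw [norm_mul, Complex.norm_exp]
    have h4 : (π * I * e n * τ : ℂ).re = -(π * e n * τ.im) := by simp
    rw [h4]
    refine (mul_le_of_le_one_left (Real.exp_pos _).le (hu n)).trans (Real.exp_le_exp.2 ?_)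
    have : (e n : ℝ) ≤ π * e n * τ.im := by
      nlinarith [Real.pi_gt_three, mul_nonneg h1 (sub_nonneg.2 h3)]
    linarith

lemma abs_le_mul_succ_add_one (n : ℤ) : |n| ≤ n * (n + 1) + 1 := by
  rcases abs_cases n with ⟨h, _⟩ | ⟨h, _⟩ <;> rw [h] <;> nlinarith [sq_nonneg (n + 1), sq_nonneg n]

lemma abs_le_succ_sq_add_one (n : ℤ) : |n| ≤ (n + 1) ^ 2 + 1 := by
  rcases abs_cases n with ⟨h, _⟩ | ⟨h, _⟩ <;> rw [h] <;>
    nlinarith [sq_nonneg (n + 1), sq_nonneg (n + 2), sq_nonneg n]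

lemma tendsto_exp_mul_thetaChar_zero_half :
    Tendsto (fun τ : UpperHalfPlane => cexp (-(π * I * τ / 4)) * thetaChar 0 (1 / 2) τ)
      UpperHalfPlane.atImInfty (𝓝 (-2)) := by
  have h := tendsto_tsum_mul_exp (u := fun _ => -1) (by simp) (e := fun n => n * (n + 1))
    (fun n => by
      rcases le_or_gt 0 n with h | h
      · positivity
      · nlinarith) abs_le_mul_succ_add_one
  have hsum : (∑' n : ℤ, if n * (n + 1) = 0 then (-1 : ℂ) else 0) = -2 := by
    rw [tsum_eq_sum (s := {0, -1})]
    · norm_num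
    · intro n hn
      simp only [Finset.mem_insert, Finset.mem_singleton, not_or] at hn
      rw [if_neg]
      rw [mul_eq_zero, not_or]
      omega
  rw [hsum] at h
  refine h.congr fun τ => ?_
  rw [thetaChar_eq_tsum, ← tsum_mul_left, ← tsum_mul_left]
  refine tsum_congr fun n => ?_
  rw [← Complex.exp_pi_mul_I]
  simp only [← Complex.exp_add]
  refine Complex.exp_eq_exp_iff_exists_int.2 ⟨-n, ?_⟩
  push_cast
  ring

lemma tendsto_thetaChar_half {b : ℝ} :
    Tendsto (fun τ : UpperHalfPlane => thetaChar (1 / 2) b τ)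
      UpperHalfPlane.atImInfty (𝓝 (cexp (-(π * I * (b + 1) / 2)))) := by
  have h := tendsto_tsum_mul_exp
    (u := fun n => cexp (π * I * b / 2) * cexp (2 * π * I * (n + 1 / 2) * (b + 1 / 2)))
    (fun n => by
      rw [← Complex.exp_add]
      refine le_of_eq ?_
      rw [Complex.norm_exp, Real.exp_eq_one_iff]
      simp) (e := fun n => (n + 1) ^ 2) (fun n => by positivity)
    abs_le_succ_sq_add_one
  rw [tsum_eq_single (-1), if_pos (by norm_num)] at h
  · have e : cexp (π * I * b / 2) *
        cexp (2 * π * I * ((-1 : ℤ) + 1 / 2) * (b + 1 / 2)) = cexp (-(π * I * (b + 1) / 2)) := by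
      rw [← Complex.exp_add]
      congr 1
      push_cast
      ring
    rw [e] at h
    refine h.congr fun τ => ?_
    rw [thetaChar_eq_tsum, ← tsum_mul_left]
    refine tsum_congr fun n => ?_
    simp only [← Complex.exp_add]
    congr 1
    push_cast
    ring
  · intro n hn
    rw [if_neg]
    intro h0
    exact hn (by have := pow_eq_zero_iff (two_ne_zero) |>.1 h0; omega)

/-- The product of the eighth powers of the theta functions at the three points of order two. -/
def thetaProd (τ : UpperHalfPlane) : ℂ :=
  (thetaChar 0 (1 / 2) τ * thetaChar (1 / 2) 0 τ * thetaChar (1 / 2) (1 / 2) τ) ^ 8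

lemma exp_pi_mul_I_div_four_pow : cexp (π * I / 4) ^ 24 = 1 := by
  rw [← Complex.exp_nat_mul]
  refine Complex.exp_eq_one_iff.2 ⟨3, ?_⟩
  push_cast
  ring

lemma thetaProd_S_smul (τ : UpperHalfPlane) :
    thetaProd (ModularGroup.S • τ) = (τ : ℂ) ^ 12 * thetaProd τ := by
  have h1 : thetaChar 0 (-(1 / 2)) τ ^ 8 = thetaChar 0 (1 / 2) τ ^ 8 := by
    have h := thetaChar_add_int 0 (1 / 2) 0 (-1) τ
    norm_num at h ⊢
    rw [h, Even.neg_pow (by decide)]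
  have h2 : thetaChar (1 / 2) (-(1 / 2)) τ ^ 8 = thetaChar (1 / 2) (1 / 2) τ ^ 8 := by
    have h := thetaChar_add_int (1 / 2) (1 / 2) 0 (-1) τ
    norm_num at h ⊢
    rw [h, Even.neg_pow (by decide), mul_pow, ← Complex.exp_nat_mul]
    have : cexp ((8 : ℕ) * -(π * I * (1 / 2))) = 1 :=
      Complex.exp_eq_one_iff.2 ⟨-2, by push_cast; ring⟩
    rw [this, one_mul]
  have h3 : ((-I * (τ : ℂ)) ^ (1 / 2 : ℂ)) ^ 24 = (τ : ℂ) ^ 12 := by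
    rw [← Complex.cpow_nat_mul]
    norm_num
    rw [mul_pow, show (12 : ℕ) = 4 * 3 by norm_num, pow_mul I, Complex.I_pow_four]
    norm_num
  have h4 : (-I) ^ 24 = (1 : ℂ) := by
    rw [Even.neg_pow (by decide), show 24 = 4 * 6 by norm_num, pow_mul, Complex.I_pow_four, one_pow]
  simp only [thetaProd, thetaChar_S_smul, neg_zero, mul_pow, h1, h2]
  rw [← h3]
  linear_combination ((-I * (τ : ℂ)) ^ (1 / 2 : ℂ)) ^ 24 * thetaChar 0 (1 / 2) τ ^ 8 *
    thetaChar (1 / 2) 0 τ ^ 8 * thetaChar (1 / 2) (1 / 2) τ ^ 8 * h4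

lemma thetaProd_T_smul (τ : UpperHalfPlane) :
    thetaProd (ModularGroup.T • τ) = thetaProd τ := by
  have h1 : thetaChar (1 / 2) (1 / 2 + 1 / 2) τ ^ 8 = thetaChar (1 / 2) 0 τ ^ 8 := by
    have h := thetaChar_add_int (1 / 2) 0 0 1 τ
    norm_num at h ⊢
    rw [h, Even.neg_pow (by decide), mul_pow, ← Complex.exp_nat_mul]
    have : cexp ((8 : ℕ) * (π * I * (1 / 2))) = 1 :=
      Complex.exp_eq_one_iff.2 ⟨2, by push_cast; ring⟩
    rw [this, one_mul]
  simp only [thetaProd, thetaChar_T_smul, mul_pow, h1, zero_add, add_zero]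
  linear_combination thetaChar 0 (1 / 2) τ ^ 8 *
    thetaChar (1 / 2) 0 τ ^ 8 * thetaChar (1 / 2) (1 / 2) τ ^ 8 * exp_pi_mul_I_div_four_pow

lemma tendsto_exp_mul_thetaProd :
    Tendsto (fun τ : UpperHalfPlane => cexp (-(2 * π * I * τ)) * thetaProd τ)
      UpperHalfPlane.atImInfty (𝓝 ((-2 * cexp (-(π * I * ((0 : ℝ) + 1) / 2)) *
        cexp (-(π * I * ((1 / 2 : ℝ) + 1) / 2))) ^ 8)) := by
  refine (((tendsto_exp_mul_thetaChar_zero_half.mul tendsto_thetaChar_half).mul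
    tendsto_thetaChar_half).pow 8).congr fun τ => ?_
  have : cexp (-(2 * π * I * τ)) = cexp (-(π * I * τ / 4)) ^ 8 := by
    rw [← Complex.exp_nat_mul]
    congr 1
    push_cast
    ring
  rw [thetaProd, this]
  ring

lemma thetaProd_slash (γ : SL(2, ℤ)) : thetaProd ∣[(12 : ℤ)] γ = thetaProd := by
  refine SlashInvariantForm.slash_action_generators_SL2Z ?_ ?_ γ
  · ext τ
    have hτ : (τ : ℂ) ≠ 0 := UpperHalfPlane.ne_zero τ
    rw [ModularForm.SL_slash_apply, thetaProd_S_smul, ← lin_eq_denom]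
    simp [lin, ModularGroup.S]
    field_simp
  · ext τ
    rw [ModularForm.SL_slash_apply, thetaProd_T_smul, ← lin_eq_denom]
    simp [lin, ModularGroup.T]

lemma thetaProd_isZeroAtImInfty : UpperHalfPlane.IsZeroAtImInfty thetaProd := by
  have h := (UpperHalfPlane.qParam_tendsto_atImInfty zero_lt_one).mul tendsto_exp_mul_thetaProd
  rw [zero_mul] at h
  refine h.congr fun τ => ?_
  rw [← mul_assoc, Function.Periodic.qParam, ← Complex.exp_add]
  simp

/-- The product of the eighth powers of the three theta functions, as a cusp form of weight `12`. -/
def thetaProdCuspForm : CuspForm 𝒮ℒ 12 where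
  toFun := thetaProd
  slash_action_eq' A hA := by
    obtain ⟨γ, rfl⟩ := hA
    exact thetaProd_slash γ
  holo' := by
    rw [UpperHalfPlane.mdifferentiable_iff]
    intro z hz
    have h : DifferentiableAt ℂ (fun z => (thetaChar 0 (1 / 2) z * thetaChar (1 / 2) 0 z *
        thetaChar (1 / 2) (1 / 2) z) ^ 8) z :=
      (((differentiableAt_thetaChar _ _ hz).mul (differentiableAt_thetaChar _ _ hz)).mul
        (differentiableAt_thetaChar _ _ hz)).pow 8
    refine h.differentiableWithinAt.congr (fun w hw => ?_) ?_
    · simp [thetaProd, UpperHalfPlane.ofComplex_apply_of_im_pos hw]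
    · simp [thetaProd, UpperHalfPlane.ofComplex_apply_of_im_pos hz]
  zero_at_cusps' hc := by
    rw [Subgroup.IsArithmetic.isCusp_iff_isCusp_SL2Z] at hc
    rw [OnePoint.isZeroAt_iff_forall_SL2Z hc]
    intro γ _
    rw [thetaProd_slash]
    exact thetaProd_isZeroAtImInfty

/-- There is only one cusp form of weight `12` up to scalars, so the product of the theta functions
vanishes nowhere because the discriminant does not. -/
lemma thetaProd_ne_zero (τ : UpperHalfPlane) : thetaProd τ ≠ 0 := by
  obtain ⟨c, hc⟩ := CuspForm.exists_smul_discriminant_of_weight_eq_twelve thetaProdCuspForm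
  have h : ∀ τ, thetaProd τ = c * ModularForm.discriminant τ := fun τ =>
    (congrArg (fun f : CuspForm 𝒮ℒ 12 => f τ) hc).symm
  rw [h]
  refine mul_ne_zero (fun h0 => ?_) (ModularForm.discriminant_ne_zero τ)
  have h1 := tendsto_exp_mul_thetaProd
  -- if `c = 0`, the non-zero limit at `i∞` would vanish
  simp only [h, h0, zero_mul, mul_zero] at h1
  have h2 := tendsto_nhds_unique h1 tendsto_const_nhds
  simp [Complex.exp_ne_zero] at h2

lemma thetaChar_zero_half_ne_zero (τ : UpperHalfPlane) : thetaChar 0 (1 / 2) τ ≠ 0 := fun h =>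
  thetaProd_ne_zero τ (by rw [thetaProd, h]; ring)

/-! ### The lattice sum of weight one -/

/-- The term of `latticeSum a b` at the lattice point `mz + n`, where `p = (m, n)`. -/
def latticeTerm (a b : ℝ) (z : ℂ) (p : ℤ × ℤ) : ℂ :=
  (-1) ^ (p.1 * p.2 + p.1 + p.2) * cexp (π * I * (p.1 * b - p.2 * a)) *
    (Real.exp (-π * ‖(p.1 + a) * z + (p.2 + b)‖ ^ 2 / (2 * z.im)) : ℝ) /
      ((p.1 + a) * z + (p.2 + b))

/-- The sum of `ψ(ω) e^{-π|ω + w|²/(2 Im z)} / (ω + w)` over the lattice points `ω = mz + n`, where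
`w = az + b` and where the unitary factor
`ψ(ω) = (-1)^{mn + m + n} e^{πi(mb - na)}` depends only on the position of `ω` modulo twice the
lattice and on the symplectic pairing of `ω` with `w`. -/
def latticeSum (a b : ℝ) (z : ℂ) : ℂ := ∑' p : ℤ × ℤ, latticeTerm a b z p

lemma neg_one_zpow_congr {k l : ℤ} (h : Even (k - l)) : (-1 : ℂ) ^ k = (-1) ^ l := by
  rw [← sub_add_cancel k l, zpow_add₀ (by norm_num), h.neg_one_zpow, one_mul]

lemma latticeSum_S_smul (a b : ℝ) (τ : UpperHalfPlane) :
    latticeSum a b (ModularGroup.S • τ : UpperHalfPlane) = τ * latticeSum b (-a) τ := by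
  have hτ : (τ : ℂ) ≠ 0 := UpperHalfPlane.ne_zero τ
  let e : ℤ × ℤ ≃ ℤ × ℤ :=
    { toFun := fun p => (p.2, -p.1)
      invFun := fun p => (-p.2, p.1)
      left_inv := fun p => by simp
      right_inv := fun p => by simp }
  rw [latticeSum, latticeSum, ← e.tsum_eq (latticeTerm b (-a) τ), ← tsum_mul_left]
  refine tsum_congr fun ⟨m, n⟩ => ?_
  have hz : ((m : ℂ) + a) * (-1 / τ) + (n + b) =
      ((n + b) * τ + ((-m : ℤ) + (-a : ℝ))) / τ := by
    push_cast
    field_simp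
    ring
  have him : (-1 / (τ : ℂ)).im = (τ : ℂ).im / ‖(τ : ℂ)‖ ^ 2 := by
    rw [← Complex.normSq_eq_norm_sq]
    simp [neg_div, Complex.inv_im]
  have hexp : ((m : ℂ) * b - n * a) = n * (-a : ℝ) - (-m : ℤ) * b := by push_cast; ring
  rw [coe_S_smul]
  simp only [latticeTerm, e, Equiv.coe_fn_mk]
  rw [hz, him, hexp, neg_one_zpow_congr (k := m * n + m + n) (l := n * -m + n + -m)
    ⟨m * n + m, by ring⟩]
  generalize hZ : ((n : ℂ) + b) * τ + ((-m : ℤ) + (-a : ℝ)) = Z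
  have h0 : ‖(τ : ℂ)‖ ≠ 0 := norm_ne_zero_iff.2 hτ
  have hq : -π * ‖Z / τ‖ ^ 2 / (2 * ((τ : ℂ).im / ‖(τ : ℂ)‖ ^ 2)) =
      -π * ‖Z‖ ^ 2 / (2 * (τ : ℂ).im) := by
    rw [norm_div]
    field_simp
  rw [hq]
  field_simp

lemma latticeSum_T_smul (a b : ℝ) (τ : UpperHalfPlane) :
    latticeSum a b (ModularGroup.T • τ : UpperHalfPlane) = latticeSum a (a + b) τ := by
  let e : ℤ × ℤ ≃ ℤ × ℤ :=
    { toFun := fun p => (p.1, p.2 + p.1)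
      invFun := fun p => (p.1, p.2 - p.1)
      left_inv := fun p => by simp
      right_inv := fun p => by simp }
  rw [latticeSum, latticeSum, ← e.tsum_eq (latticeTerm a (a + b) τ)]
  refine tsum_congr fun ⟨m, n⟩ => ?_
  have hz : ((m : ℂ) + a) * (τ + 1) + (n + b) =
      (m + a) * τ + ((n + m : ℤ) + (a + b : ℝ)) := by
    push_cast
    ring
  have him : ((τ : ℂ) + 1).im = (τ : ℂ).im := by simp
  have hexp : ((m : ℂ) * b - n * a) = m * (a + b : ℝ) - (n + m : ℤ) * a := by push_cast; ring
  rw [coe_T_smul]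
  simp only [latticeTerm, e, Equiv.coe_fn_mk]
  obtain ⟨l, hl⟩ := Int.even_mul_succ_self m
  rw [hz, him, hexp, neg_one_zpow_congr (k := m * n + m + n) (l := m * (n + m) + m + (n + m))
    ⟨-l, by linear_combination -hl⟩]

lemma latticeSum_add_int (a b : ℝ) (m n : ℤ) (z : ℂ) :
    latticeSum (a + m) (b + n) z =
      (-1) ^ (m * n + m + n) * cexp (π * I * (n * a - m * b)) * latticeSum a b z := by
  rw [latticeSum, latticeSum, ← (Equiv.addRight (m, n)).tsum_eq (latticeTerm a b z),
    ← tsum_mul_left]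
  refine tsum_congr fun ⟨k, l⟩ => ?_
  have hz : ((k : ℂ) + (a + m : ℝ)) * z + (l + (b + n : ℝ)) =
      ((k + m : ℤ) + a) * z + ((l + n : ℤ) + b) := by
    push_cast
    ring
  have hψ : (-1 : ℂ) ^ (k * l + k + l) * cexp (π * I * (k * (b + n : ℝ) - l * (a + m : ℝ))) =
      (-1) ^ (m * n + m + n) * cexp (π * I * (n * a - m * b)) *
        ((-1) ^ ((k + m) * (l + n) + (k + m) + (l + n)) *
          cexp (π * I * ((k + m : ℤ) * b - (l + n : ℤ) * a))) := by
    simp only [← exp_pi_mul_I_mul_int, ← Complex.exp_add]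
    refine Complex.exp_eq_exp_iff_exists_int.2 ⟨-(m * n + m + n) - l * m, ?_⟩
    push_cast
    ring
  simp only [latticeTerm, Equiv.coe_addRight, Prod.mk_add_mk]
  rw [hz, hψ]
  ring

/-- At half-integral characteristics the terms of the lattice sum are dominated by the terms of an
absolutely convergent Eisenstein series of weight three. -/
lemma norm_latticeTerm_le (p r : ℤ) {τ : UpperHalfPlane} (q : ℤ × ℤ) :
    ‖latticeTerm (p / 2) (r / 2) τ q‖ ≤ 16 * τ.im *
      ‖((2 * q.1 + p : ℤ) : ℂ) * τ + ((2 * q.2 + r : ℤ) : ℂ)‖ ^ (-3 : ℝ) := by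
  obtain ⟨m, n⟩ := q
  have hz : ((m : ℂ) + (p / 2 : ℝ)) * τ + (n + (r / 2 : ℝ)) =
      (((2 * m + p : ℤ) : ℂ) * τ + ((2 * n + r : ℤ) : ℂ)) / 2 := by
    push_cast
    ring
  have hu : ‖cexp (π * I * (m * (r / 2 : ℝ) - n * (p / 2 : ℝ)))‖ = 1 := by
    rw [Complex.norm_exp, Real.exp_eq_one_iff]
    simp
  simp only [latticeTerm]
  rw [hz]
  generalize ((2 * m + p : ℤ) : ℂ) * (τ : ℂ) + ((2 * n + r : ℤ) : ℂ) = Z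
  rw [norm_div, norm_mul, norm_mul, hu, norm_zpow, norm_neg, norm_one, one_zpow, one_mul, one_mul,
    Complex.norm_real, Real.norm_of_nonneg (Real.exp_pos _).le, norm_div, Complex.norm_two]
  have hy := τ.im_pos
  rcases eq_or_ne Z 0 with rfl | hZ
  · simp
  have hZ' : 0 < ‖Z‖ := norm_pos_iff.2 hZ
  have hs : Real.exp (-π * (‖Z‖ / 2) ^ 2 / (2 * (τ : ℂ).im)) ≤ 8 * τ.im / ‖Z‖ ^ 2 := by
    have h1 : 0 < ‖Z‖ ^ 2 / (8 * τ.im) := by positivity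
    have h2 : -π * (‖Z‖ / 2) ^ 2 / (2 * (τ : ℂ).im) ≤ -(‖Z‖ ^ 2 / (8 * τ.im)) := by
      have : -π * (‖Z‖ / 2) ^ 2 / (2 * (τ : ℂ).im) = -(π * (‖Z‖ ^ 2 / (8 * τ.im))) := by
        rw [UpperHalfPlane.coe_im]
        field_simp
        ring
      rw [this]
      nlinarith [Real.pi_gt_three]
    refine (Real.exp_le_exp.2 h2).trans ?_
    rw [Real.exp_neg, show 8 * τ.im / ‖Z‖ ^ 2 = (‖Z‖ ^ 2 / (8 * τ.im))⁻¹ by rw [inv_div]]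
    gcongr
    linarith [Real.add_one_le_exp (‖Z‖ ^ 2 / (8 * τ.im))]
  rw [Real.rpow_neg hZ'.le]
  norm_cast
  rw [div_le_iff₀ (by positivity)]
  refine hs.trans (le_of_eq ?_)
  field_simp
  ring

lemma injective_two_mul_add (p r : ℤ) :
    Function.Injective fun q : ℤ × ℤ => (![2 * q.1 + p, 2 * q.2 + r] : Fin 2 → ℤ) := by
  rintro ⟨m, n⟩ ⟨m', n'⟩ h
  have h0 := congrFun h 0
  have h1 := congrFun h 1
  simp at h0 h1
  rw [h0, h1]

lemma summable_latticeTerm (p r : ℤ) (τ : UpperHalfPlane) :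
    Summable (latticeTerm (p / 2) (r / 2) τ) := by
  have h := (EisensteinSeries.summable_one_div_norm_rpow (k := 3) (by norm_num)).comp_injective
    (injective_two_mul_add p r)
  refine Summable.of_norm_bounded
    (h.mul_left (16 * τ.im * EisensteinSeries.r τ ^ (-3 : ℝ))) fun q => ?_
  have hpos : 0 ≤ 16 * τ.im := mul_nonneg (by norm_num) τ.im_pos.le
  have hb := EisensteinSeries.summand_bound τ (k := 3) (by norm_num) ![2 * q.1 + p, 2 * q.2 + r]
  refine (norm_latticeTerm_le p r q).trans
    ((mul_le_mul_of_nonneg_left hb hpos).trans_eq ?_)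
  simp only [Function.comp_apply]
  ring

/-- In the strip `|Re τ| ≤ 1`, `Im τ ≥ 1`, the lattice sums at half-integral characteristics grow
at most linearly in `Im τ`, uniformly in the characteristic. -/
lemma exists_norm_latticeSum_le : ∃ B : ℝ, ∀ (p r : ℤ) (τ : UpperHalfPlane), |τ.re| ≤ 1 →
    1 ≤ τ.im → ‖latticeSum (p / 2) (r / 2) τ‖ ≤ B * τ.im := by
  have hs := EisensteinSeries.summable_one_div_norm_rpow (k := 3) (by norm_num)
  set r₀ := EisensteinSeries.r ⟨⟨1, 1⟩, one_pos⟩ with hr₀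
  refine ⟨16 * (r₀ ^ (-3 : ℝ) * ∑' x : Fin 2 → ℤ, ‖x‖ ^ (-3 : ℝ)), fun p r τ hre him => ?_⟩
  have hpos := τ.im_pos
  have hb : ∀ q, ‖latticeTerm (p / 2) (r / 2) τ q‖ ≤ 16 * τ.im * (r₀ ^ (-3 : ℝ) *
      ‖(![2 * q.1 + p, 2 * q.2 + r] : Fin 2 → ℤ)‖ ^ (-3 : ℝ)) := fun q => by
    refine (norm_latticeTerm_le p r q).trans ?_
    gcongr
    exact EisensteinSeries.summand_bound_of_mem_verticalStrip (k := 3) (by norm_num)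
      ![2 * q.1 + p, 2 * q.2 + r] one_pos ⟨hre, him⟩
  have hc := hs.comp_injective (injective_two_mul_add p r)
  have h1 := tsum_of_norm_bounded
    ((hc.mul_left (r₀ ^ (-3 : ℝ))).mul_left (16 * τ.im)).hasSum hb
  refine h1.trans ?_
  rw [tsum_mul_left, tsum_mul_left]
  have h2 := tsum_comp_le_tsum_of_inj hs (fun x => by positivity) (injective_two_mul_add p r)
  have h3 : 0 ≤ r₀ ^ (-3 : ℝ) := Real.rpow_nonneg (EisensteinSeries.r_pos _).le _
  calc _ ≤ 16 * τ.im * (r₀ ^ (-3 : ℝ) * ∑' x : Fin 2 → ℤ, ‖x‖ ^ (-3 : ℝ)) := by gcongr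
    _ = _ := by ring

/-- In the half-plane `Im τ ≥ 1`, the lattice sums at half-integral characteristics grow
at most linearly in `Im τ`. -/
lemma exists_norm_latticeSum_le_mul_im : ∃ B : ℝ, ∀ (p r : ℤ) (τ : UpperHalfPlane),
    1 ≤ τ.im → ‖latticeSum (p / 2) (r / 2) τ‖ ≤ B * τ.im := by
  obtain ⟨B, hB⟩ := exists_norm_latticeSum_le
  refine ⟨B, fun p r τ him => ?_⟩
  have hstep : ∀ (n : ℕ) (p r : ℤ) (τ : UpperHalfPlane), |τ.re| ≤ n + 1 → 1 ≤ τ.im →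
      ‖latticeSum (p / 2) (r / 2) τ‖ ≤ B * τ.im := by
    intro n
    induction n with
    | zero => intro p r τ h1 h2; exact hB p r τ (by simpa using h1) h2
    | succ n ih =>
      intro p r τ h1 h2
      rcases le_or_gt |τ.re| (n + 1) with h | h
      · exact ih p r τ h h2
      · push_cast at h1
        rcases abs_cases τ.re with ⟨h3, _⟩ | ⟨h3, _⟩
        · have e : ModularGroup.T • ((-1 : ℝ) +ᵥ τ) = τ := by
            rw [UpperHalfPlane.modular_T_smul, vadd_vadd]; simp
          have hre : |((-1 : ℝ) +ᵥ τ).re| ≤ n + 1 := by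
            rw [UpperHalfPlane.vadd_re, abs_le]
            constructor <;> linarith
          have h4 := ih p (p + r) ((-1 : ℝ) +ᵥ τ) hre (by rwa [UpperHalfPlane.vadd_im])
          rw [UpperHalfPlane.vadd_im] at h4
          rw [← e, latticeSum_T_smul, e]
          push_cast at h4
          rwa [add_div] at h4
        · have hre : |(ModularGroup.T • τ).re| ≤ n + 1 := by
            rw [UpperHalfPlane.modular_T_smul, UpperHalfPlane.vadd_re, abs_le]
            constructor <;> linarith
          have him' : (ModularGroup.T • τ).im = τ.im := by
            rw [UpperHalfPlane.modular_T_smul, UpperHalfPlane.vadd_im]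
          have h4 := ih p (r - p) (ModularGroup.T • τ) hre (by rwa [him'])
          rw [him', latticeSum_T_smul] at h4
          have e : (p / 2 : ℝ) + ((r - p : ℤ) : ℝ) / 2 = r / 2 := by push_cast; ring
          rwa [e] at h4
  obtain ⟨n, hn⟩ := exists_nat_ge |τ.re|
  exact hstep n p r τ (by linarith) him

/-! ### Gaussian bounds -/

lemma summable_exp_linear_sub_gaussian (B : ℝ) {y : ℝ} (hy : 0 < y) :
    Summable fun n : ℤ => Real.exp (B * |(n : ℝ) + 1 / 2| - π * y * ((n : ℝ) + 1 / 2) ^ 2) := by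
  have h := summable_pow_mul_jacobiTheta₂_term_bound (y / 2 + |B| / (2 * π)) hy 0
  refine Summable.of_nonneg_of_le (fun n => (Real.exp_pos _).le) (fun n => ?_)
    (h.mul_left (Real.exp (|B| / 2)))
  rw [pow_zero, one_mul, ← Real.exp_add]
  refine Real.exp_le_exp.2 ?_
  have h1 : B * |(n : ℝ) + 1 / 2| ≤ |B| * (|(n : ℝ)| + 1 / 2) := by
    refine (mul_le_mul_of_nonneg_right (le_abs_self B) (abs_nonneg _)).trans ?_
    refine mul_le_mul_of_nonneg_left ?_ (abs_nonneg _)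
    exact (abs_add_le _ _).trans_eq (by norm_num)
  have h2 : (n : ℝ) ^ 2 - |(n : ℝ)| ≤ ((n : ℝ) + 1 / 2) ^ 2 := by
    nlinarith [neg_abs_le (n : ℝ)]
  have h3 : -π * (y * (n : ℝ) ^ 2 - 2 * (y / 2 + |B| / (2 * π)) * |(n : ℝ)|) =
      -(π * y) * ((n : ℝ) ^ 2 - |(n : ℝ)|) + |B| * |(n : ℝ)| := by
    have := Real.pi_ne_zero
    field_simp
    ring
  rw [Int.cast_abs, h3]
  nlinarith [mul_le_mul_of_nonneg_left h2 (mul_pos Real.pi_pos hy).le]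

lemma summable_pow_mul_gaussian (k : ℕ) {y : ℝ} (hy : 0 < y) :
    Summable fun n : ℤ => |(n : ℝ) + 1 / 2| ^ k * Real.exp (-(π * y * ((n : ℝ) + 1 / 2) ^ 2)) := by
  refine Summable.of_nonneg_of_le (fun n => by positivity) (fun n => ?_)
    ((summable_exp_linear_sub_gaussian 1 hy).mul_left (k.factorial : ℝ))
  rw [sub_eq_add_neg, Real.exp_add, one_mul, ← mul_assoc]
  gcongr
  have h := Real.pow_div_factorial_le_exp _ (abs_nonneg ((n : ℝ) + 1 / 2)) k
  rwa [div_le_iff₀' (by positivity)] at h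

/-! ### The error function -/

lemma continuous_gaussian : Continuous fun t : ℝ => Real.exp (-π * t ^ 2) := by fun_prop

lemma hasDerivAt_errE (x : ℝ) : HasDerivAt errE (2 * Real.exp (-π * x ^ 2)) x :=
  (intervalIntegral.integral_hasDerivAt_right (continuous_gaussian.intervalIntegrable _ _)
    (continuous_gaussian.stronglyMeasurableAtFilter _ _) continuous_gaussian.continuousAt).const_mul 2

lemma errE_neg (x : ℝ) : errE (-x) = -errE x := by
  have h := intervalIntegral.integral_comp_neg (a := 0) (b := x)
    (fun t : ℝ => Real.exp (-π * t ^ 2))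
  simp only [neg_sq, neg_zero] at h
  rw [errE, errE, h, intervalIntegral.integral_symm]
  ring

lemma monotone_errE : Monotone errE :=
  monotone_of_deriv_nonneg (fun x => (hasDerivAt_errE x).differentiableAt) fun x => by
    rw [(hasDerivAt_errE x).deriv]; positivity

lemma tendsto_errE : Tendsto errE atTop (𝓝 1) := by
  have hi : MeasureTheory.IntegrableOn (fun t : ℝ => Real.exp (-π * t ^ 2)) (Set.Ioi 0) :=
    (integrable_exp_neg_mul_sq Real.pi_pos).integrableOn
  have h := (MeasureTheory.intervalIntegral_tendsto_integral_Ioi 0 hi tendsto_id).const_mul 2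
  rw [integral_gaussian_Ioi, div_self Real.pi_ne_zero, Real.sqrt_one,
    mul_div_cancel₀ _ (two_ne_zero' ℝ)] at h
  refine h.congr fun x => ?_
  rw [errE, id]

lemma errE_sub_le {x : ℝ} (hx : 0 ≤ x) (X : ℝ) (hX : x ≤ X) :
    errE X - errE x ≤ Real.exp (-π * x ^ 2) := by
  have h1 : errE X - errE x = 2 * ∫ t in (0 : ℝ)..(X - x), Real.exp (-π * (t + x) ^ 2) := by
    have h := intervalIntegral.integral_comp_add_right (a := 0) (b := X - x)
      (fun t : ℝ => Real.exp (-π * t ^ 2)) x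
    rw [zero_add, sub_add_cancel] at h
    rw [h, errE, errE, ← mul_sub, intervalIntegral.integral_interval_sub_left]
    · exact continuous_gaussian.intervalIntegrable _ _
    · exact continuous_gaussian.intervalIntegrable _ _
  have h2 : (∫ t in (0 : ℝ)..(X - x), Real.exp (-π * (t + x) ^ 2)) ≤
      ∫ t in (0 : ℝ)..(X - x), Real.exp (-π * x ^ 2) * Real.exp (-π * t ^ 2) := by
    refine intervalIntegral.integral_mono_on (sub_nonneg.2 hX)
      (Continuous.intervalIntegrable (by fun_prop) _ _)
      (Continuous.intervalIntegrable (by fun_prop) _ _) fun t ht => ?_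
    rw [← Real.exp_add]
    refine Real.exp_le_exp.2 ?_
    nlinarith [mul_nonneg Real.pi_pos.le (mul_nonneg ht.1 hx)]
  rw [intervalIntegral.integral_const_mul] at h2
  have h3 : errE (X - x) ≤ 1 := monotone_errE.ge_of_tendsto tendsto_errE _
  have h4 : (∫ t in (0 : ℝ)..(X - x), Real.exp (-π * t ^ 2)) = errE (X - x) / 2 := by
    rw [errE]; ring
  rw [h4] at h2
  rw [h1]
  nlinarith [Real.exp_pos (-π * x ^ 2)]

lemma abs_sign_sub_errE_le {x : ℝ} (hx : x ≠ 0) :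
    |Real.sign x - errE x| ≤ Real.exp (-π * x ^ 2) := by
  have key : ∀ x : ℝ, 0 < x → |Real.sign x - errE x| ≤ Real.exp (-π * x ^ 2) := fun x hx => by
    have h1 : errE x ≤ 1 := monotone_errE.ge_of_tendsto tendsto_errE _
    rw [Real.sign_of_pos hx, abs_of_nonneg (sub_nonneg.2 h1)]
    refine le_of_tendsto (tendsto_errE.sub_const (errE x)) ?_
    filter_upwards [eventually_ge_atTop x] with X hX using errE_sub_le hx.le X hX
  rcases hx.lt_or_gt with h | h
  · have h1 := key (-x) (neg_pos.2 h)
    rwa [Real.sign_neg, errE_neg, neg_sub_neg, neg_sq, abs_sub_comm] at h1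
  · exact key x h

/-- The difference of two values of `E` as an integral over a fixed interval. -/
lemma errE_sub_errE_eq (ν c : ℝ) :
    errE (ν * c) - errE ((ν - 1) * c) =
      2 * c * ∫ s in (0 : ℝ)..1, Real.exp (-π * ((ν - s) * c) ^ 2) := by
  have h := intervalIntegral.smul_integral_comp_sub_mul (a := 0) (b := 1)
    (fun t : ℝ => Real.exp (-π * t ^ 2)) c (ν * c)
  have h1 : ∀ s, ν * c - c * s = (ν - s) * c := fun s => by ring
  simp only [h1, sub_zero, smul_eq_mul] at h
  rw [mul_assoc, h, errE, errE, ← mul_sub, intervalIntegral.integral_interval_sub_left]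
  · exact continuous_gaussian.intervalIntegrable _ _
  · exact continuous_gaussian.intervalIntegrable _ _

/-- The coefficient `sgn ν - E(ν √(2y))`, where `ν = n + 1/2`. -/
def errCoeff (y : ℝ) (n : ℤ) : ℝ :=
  Real.sign ((n : ℝ) + 1 / 2) - errE (((n : ℝ) + 1 / 2) * √(2 * y))

lemma int_add_half_ne_zero (n : ℤ) : (n : ℝ) + 1 / 2 ≠ 0 := fun h => by
  have h1 : ((2 * n + 1 : ℤ) : ℝ) = 0 := by push_cast; linarith
  have h2 : 2 * n + 1 = 0 := by exact_mod_cast h1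
  omega

lemma abs_errCoeff_le {y : ℝ} (hy : 0 < y) (n : ℤ) :
    |errCoeff y n| ≤ Real.exp (-(2 * π * y * ((n : ℝ) + 1 / 2) ^ 2)) := by
  have hc : 0 < √(2 * y) := Real.sqrt_pos.2 (by positivity)
  have hsign : Real.sign ((n : ℝ) + 1 / 2) = Real.sign (((n : ℝ) + 1 / 2) * √(2 * y)) := by
    rcases (int_add_half_ne_zero n).lt_or_gt with h | h
    · rw [Real.sign_of_neg h, Real.sign_of_neg (mul_neg_of_neg_of_pos h hc)]
    · rw [Real.sign_of_pos h, Real.sign_of_pos (mul_pos h hc)]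
  rw [errCoeff, hsign]
  refine (abs_sign_sub_errE_le (mul_ne_zero (int_add_half_ne_zero n) hc.ne')).trans_eq ?_
  rw [mul_pow, Real.sq_sqrt (by positivity)]
  ring_nf

lemma errCoeff_sub_errCoeff (y : ℝ) (n : ℤ) :
    errCoeff y n - errCoeff y (n - 1) = (if n = 0 then 2 else 0) -
      2 * √(2 * y) * ∫ s in (0 : ℝ)..1, Real.exp (-π * (((n : ℝ) + 1 / 2 - s) * √(2 * y)) ^ 2) := by
  rw [← errE_sub_errE_eq, errCoeff, errCoeff]
  have h : Real.sign ((n : ℝ) + 1 / 2) - Real.sign (((n - 1 : ℤ) : ℝ) + 1 / 2) =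
      if n = 0 then 2 else 0 := by
    rcases lt_trichotomy n 0 with h | h | h
    · have h1 : (n : ℝ) ≤ -1 := by exact_mod_cast Int.le_sub_one_of_lt h
      rw [Real.sign_of_neg (by linarith), Real.sign_of_neg (by push_cast; linarith), if_neg h.ne]
      ring
    · subst h
      rw [Real.sign_of_pos (by norm_num), Real.sign_of_neg (by norm_num)]
      norm_num
    · have h1 : (1 : ℝ) ≤ n := by exact_mod_cast h
      rw [Real.sign_of_pos (by linarith), Real.sign_of_pos (by push_cast; linarith), if_neg h.ne']
      ring
  rw [← h]
  push_cast
  ring_nf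

/-! ### The Lerch sum -/

lemma norm_exp_pi_mul_I_sq (ν : ℝ) (z : ℂ) :
    ‖cexp (π * I * ν ^ 2 * z)‖ = Real.exp (-(π * z.im * ν ^ 2)) := by
  rw [Complex.norm_exp]
  congr 1
  have : (π * I * ν ^ 2 * z : ℂ) = ((π * ν ^ 2 : ℝ) : ℂ) * (I * z) := by push_cast; ring
  rw [this, Complex.re_ofReal_mul]
  simp
  ring

lemma norm_exp_two_pi_mul_I_mul (x : ℝ) (z : ℂ) :
    ‖cexp (2 * π * I * x * z)‖ = Real.exp (-(2 * π * x * z.im)) := by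
  rw [Complex.norm_exp]
  congr 1
  have : (2 * π * I * x * z : ℂ) = ((2 * π * x : ℝ) : ℂ) * (I * z) := by push_cast; ring
  rw [this, Complex.re_ofReal_mul]
  simp

lemma le_norm_one_add_exp {y : ℝ} (hy : 0 < y) {z : ℂ} (hz : y ≤ z.im) (n : ℤ) :
    1 - Real.exp (-(2 * π * y)) ≤ ‖1 + cexp (2 * π * I * n * z)‖ := by
  have hn := norm_exp_two_pi_mul_I_mul n z
  push_cast at hn
  have hy' := mul_pos Real.pi_pos hy
  rcases lt_trichotomy n 0 with h | h | h
  · have h1 : (n : ℝ) ≤ -1 := by exact_mod_cast Int.le_sub_one_of_lt h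
    have h2 := norm_sub_norm_le (cexp (2 * π * I * n * z)) (-1)
    rw [sub_neg_eq_add, add_comm, norm_neg, norm_one, hn] at h2
    have h3 : 2 * π * y ≤ -(2 * π * n * z.im) := by
      have : y ≤ -(n * z.im) := by nlinarith
      nlinarith [Real.pi_pos]
    have h4 : 1 ≤ Real.exp (2 * π * y) := Real.one_le_exp (by linarith)
    have h5 := Real.exp_le_exp.2 h3
    have h6 : Real.exp (2 * π * y) * Real.exp (-(2 * π * y)) = 1 := by
      rw [← Real.exp_add]; simp
    nlinarith [Real.exp_pos (-(2 * π * y))]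
  · subst h
    have : ‖(1 : ℂ) + 1‖ = 2 := by norm_num
    simp only [Int.cast_zero, mul_zero, zero_mul, Complex.exp_zero, this]
    linarith [Real.exp_pos (-(2 * π * y))]
  · have h1 : (1 : ℝ) ≤ n := by exact_mod_cast h
    have h2 := norm_sub_norm_le 1 (-cexp (2 * π * I * n * z))
    rw [sub_neg_eq_add, norm_neg, norm_one, hn] at h2
    have h3 : -(2 * π * n * z.im) ≤ -(2 * π * y) := by
      have : y ≤ n * z.im := by nlinarith
      nlinarith [Real.pi_pos]
    linarith [Real.exp_le_exp.2 h3]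

lemma one_add_exp_ne_zero {z : ℂ} (hz : 0 < z.im) (n : ℤ) : 1 + cexp (2 * π * I * n * z) ≠ 0 := by
  intro h
  have h1 := le_norm_one_add_exp hz le_rfl n
  rw [h, norm_zero] at h1
  have h2 : Real.exp (-(2 * π * z.im)) < 1 :=
    Real.exp_lt_one_iff.2 (neg_neg_of_pos (by positivity))
  linarith

/-- The term `q^{n(n+1)/2} / (1 + q^n)` of the Lerch sum, where `q = e^{2πiz}`. -/
def lerchTerm (z : ℂ) (n : ℤ) : ℂ :=
  cexp (π * I * ((n : ℂ) ^ 2 + n) * z) / (1 + cexp (2 * π * I * n * z))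

/-- The Lerch sum `∑ q^{n(n+1)/2} / (1 + q^n)`, where `q = e^{2πiz}`. -/
def lerchSum (z : ℂ) : ℂ := ∑' n : ℤ, lerchTerm z n

lemma norm_lerchTerm_le {y : ℝ} (hy : 0 < y) {z : ℂ} (hz : y ≤ z.im) (n : ℤ) :
    ‖lerchTerm z n‖ ≤ Real.exp (π * y / 4) / (1 - Real.exp (-(2 * π * y))) *
      Real.exp (-(π * y * ((n : ℝ) + 1 / 2) ^ 2)) := by
  have h2 : Real.exp (-(2 * π * y)) < 1 := Real.exp_lt_one_iff.2 (neg_neg_of_pos (by positivity))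
  have h3 : 0 ≤ ((n ^ 2 + n : ℤ) : ℝ) := by
    have : 0 ≤ n ^ 2 + n := by
      rcases le_or_gt 0 n with h | h
      · positivity
      · nlinarith
    exact_mod_cast this
  have h4 : ‖cexp (π * I * ((n : ℂ) ^ 2 + n) * z)‖ ≤
      Real.exp (π * y / 4) * Real.exp (-(π * y * ((n : ℝ) + 1 / 2) ^ 2)) := by
    have e : (π * I * ((n : ℂ) ^ 2 + n) * z : ℂ) =
        2 * π * I * (((n ^ 2 + n : ℤ) : ℝ) / 2 : ℝ) * z := by
      push_cast; ring
    rw [e, norm_exp_two_pi_mul_I_mul, ← Real.exp_add]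
    refine Real.exp_le_exp.2 ?_
    have h5 := mul_le_mul_of_nonneg_left hz (mul_nonneg Real.pi_pos.le h3)
    push_cast at h5 ⊢
    nlinarith
  rw [lerchTerm, norm_div, div_mul_eq_mul_div]
  exact div_le_div₀ (by positivity) h4 (by linarith) (le_norm_one_add_exp hy hz n)

lemma summable_lerchTerm {z : ℂ} (hz : 0 < z.im) : Summable (lerchTerm z) := by
  refine Summable.of_norm_bounded ?_ (norm_lerchTerm_le hz le_rfl)
  refine Summable.mul_left _ ?_
  simpa using summable_pow_mul_gaussian 0 hz

lemma mu_half_half (τ : UpperHalfPlane) :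
    mu (1 / 2) (1 / 2) τ = I / thetaChar 0 (1 / 2) τ * lerchSum τ := by
  have h1 : cexp (π * I * (1 / 2)) = I := by
    rw [mul_one_div, mul_div_right_comm, Complex.exp_pi_div_two_mul_I]
  rw [mu, theta_half_eq, h1, lerchSum]
  congr 1
  refine tsum_congr fun n => ?_
  have h2 : cexp (2 * π * I * n * τ + 2 * π * I * (1 / 2)) = -cexp (2 * π * I * n * τ) := by
    rw [Complex.exp_add, show (2 * π * I * (1 / 2) : ℂ) = π * I by ring, Complex.exp_pi_mul_I]
    ring
  have h3 : (-1 : ℂ) ^ n * cexp (π * I * ((n : ℂ) ^ 2 + n) * τ + 2 * π * I * n * (1 / 2)) =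
      cexp (π * I * ((n : ℂ) ^ 2 + n) * τ) := by
    rw [← exp_pi_mul_I_mul_int, ← Complex.exp_add]
    refine Complex.exp_eq_exp_iff_exists_int.2 ⟨n, ?_⟩
    ring
  rw [h2, h3, sub_neg_eq_add, lerchTerm]

/-! ### The completion as a lattice sum -/

/-- The term with `ν = n + 1/2` of `errSum k z`. -/
def errTerm (k : ℕ) (z : ℂ) (n : ℤ) : ℂ :=
  (((n : ℝ) + 1 / 2 : ℝ) : ℂ) ^ (2 * k) * (errCoeff z.im n : ℂ) * (-1) ^ n *
    cexp (-(π * I * (((n : ℝ) + 1 / 2 : ℝ) : ℂ) ^ 2 * z))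

/-- The series `∑ ν^{2k} (sgn ν - E(ν √(2y))) (-1)^{ν - 1/2} e^{-πiν²z}`, where `y = Im z`; for
`k = 0` it is `R(0; z)`. -/
def errSum (k : ℕ) (z : ℂ) : ℂ := ∑' n : ℤ, errTerm k z n

lemma R_zero_eq (τ : UpperHalfPlane) : R 0 τ = errSum 0 τ := by
  refine tsum_congr fun n => ?_
  rw [errTerm, errCoeff]
  push_cast
  simp

lemma norm_neg_one_zpow (n : ℤ) : ‖(-1 : ℂ) ^ n‖ = 1 := by
  rw [norm_zpow, norm_neg, norm_one, one_zpow]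

lemma norm_errTerm_le (k : ℕ) {z : ℂ} (hz : 0 < z.im) (n : ℤ) :
    ‖errTerm k z n‖ ≤
      |(n : ℝ) + 1 / 2| ^ (2 * k) * Real.exp (-(π * z.im * ((n : ℝ) + 1 / 2) ^ 2)) := by
  rw [errTerm, norm_mul, norm_mul, norm_mul, norm_neg_one_zpow, mul_one, norm_pow,
    Complex.norm_real, Complex.norm_real, Real.norm_eq_abs, Real.norm_eq_abs, ← mul_neg,
    norm_exp_pi_mul_I_sq, Complex.neg_im, mul_assoc]
  gcongr
  refine (mul_le_mul_of_nonneg_right (abs_errCoeff_le hz n) (Real.exp_pos _).le).trans_eq ?_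
  rw [← Real.exp_add]
  congr 1
  ring

lemma summable_norm_errTerm (k : ℕ) {z : ℂ} (hz : 0 < z.im) :
    Summable fun n => ‖errTerm k z n‖ :=
  Summable.of_nonneg_of_le (fun _ => norm_nonneg _) (norm_errTerm_le k hz)
    (summable_pow_mul_gaussian (2 * k) hz)

/-- The term `(-1)^{ν - 1/2} q^{nν}` of the `n`-th row, where `ν = j + 1/2`. -/
def rowTerm (z : ℂ) (n j : ℤ) : ℂ := (-1) ^ j * cexp (2 * π * I * n * (j + 1 / 2) * z)

lemma exp_mul_rowTerm (z : ℂ) (n j : ℤ) :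
    cexp (2 * π * I * n * z) * rowTerm z n j = -rowTerm z n (j + 1) := by
  rw [rowTerm, rowTerm, zpow_add_one₀ (by norm_num), mul_left_comm, ← Complex.exp_add]
  push_cast
  ring_nf

lemma neg_thetaChar_eq_tsum (z : ℂ) :
    -thetaChar 0 (1 / 2) z = ∑' n : ℤ, cexp (π * I * (((n : ℝ) + 1 / 2 : ℝ) : ℂ) ^ 2 * z) := by
  rw [thetaChar_eq_tsum, ← tsum_mul_left, ← tsum_neg]
  refine tsum_congr fun n => ?_
  rw [neg_eq_neg_one_mul, ← Complex.exp_pi_mul_I]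
  simp only [← Complex.exp_add]
  refine Complex.exp_eq_exp_iff_exists_int.2 ⟨n + 1, ?_⟩
  push_cast
  ring

/-- A product of two series over `ℤ`, arranged according to the difference of the indices. -/
lemma hasSum_mul_rows {F G : ℤ → ℂ} (hF : Summable fun n => ‖F n‖) (hG : Summable fun n => ‖G n‖) :
    (∀ n, Summable fun j => F j * G (j + n)) ∧
      HasSum (fun n => ∑' j, F j * G (j + n)) ((∑' n, F n) * ∑' n, G n) := by
  let e : ℤ × ℤ ≃ ℤ × ℤ :=
    { toFun := fun p => (p.2, p.2 + p.1)
      invFun := fun p => (p.2 - p.1, p.1)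
      left_inv := fun p => by simp
      right_inv := fun p => by simp }
  have hs₀ : Summable fun p : ℤ × ℤ => F p.1 * G p.2 := summable_mul_of_summable_norm hF hG
  have he : ∀ p : ℤ × ℤ, F (e p).1 * G (e p).2 = F p.2 * G (p.2 + p.1) := fun p => rfl
  have hs : Summable fun p : ℤ × ℤ => F p.2 * G (p.2 + p.1) :=
    (hs₀.comp_injective e.injective).congr he
  have h : (∑' n, F n) * ∑' n, G n = ∑' n : ℤ, ∑' j : ℤ, F j * G (j + n) := by
    rw [tsum_mul_tsum_of_summable_norm hF hG, ← e.tsum_eq fun p : ℤ × ℤ => F p.1 * G p.2,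
      tsum_congr he, hs.tsum_prod]
  rw [h]
  exact ⟨fun n => hs.prod_factor n, hs.prod.hasSum⟩

/-- The product of `R(0; z)` with the theta function, arranged in rows: the exponent
`(a² - ν²) / 2` of `q` is `n² / 2 + nν` with `n = a - ν`. -/
lemma hasSum_errSum_mul_theta {z : ℂ} (hz : 0 < z.im) :
    (∀ n : ℤ, Summable fun j => (errCoeff z.im j : ℂ) * rowTerm z n j) ∧
    HasSum (fun n : ℤ => cexp (π * I * n ^ 2 * z) * ∑' j, (errCoeff z.im j : ℂ) * rowTerm z n j)
      (errSum 0 z * -thetaChar 0 (1 / 2) z) := by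
  have hG : Summable fun n : ℤ => ‖cexp (π * I * (((n : ℝ) + 1 / 2 : ℝ) : ℂ) ^ 2 * z)‖ := by
    simp only [norm_exp_pi_mul_I_sq]
    simpa using summable_pow_mul_gaussian 0 hz
  have hterm : ∀ n j : ℤ, errTerm 0 z j *
      cexp (π * I * ((((j + n : ℤ) : ℝ) + 1 / 2 : ℝ) : ℂ) ^ 2 * z) =
      cexp (π * I * n ^ 2 * z) * ((errCoeff z.im j : ℂ) * rowTerm z n j) := by
    intro n j
    simp only [errTerm, rowTerm, mul_zero, pow_zero, one_mul]
    have : cexp (-(π * I * (((j : ℝ) + 1 / 2 : ℝ) : ℂ) ^ 2 * z)) *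
        cexp (π * I * ((((j + n : ℤ) : ℝ) + 1 / 2 : ℝ) : ℂ) ^ 2 * z) =
        cexp (π * I * n ^ 2 * z) * cexp (2 * π * I * n * (j + 1 / 2) * z) := by
      rw [← Complex.exp_add, ← Complex.exp_add]
      congr 1
      push_cast
      ring
    linear_combination (errCoeff z.im j : ℂ) * (-1) ^ j * this
  obtain ⟨h1, h2⟩ := hasSum_mul_rows (summable_norm_errTerm 0 hz) hG
  rw [neg_thetaChar_eq_tsum, errSum]
  simp only [hterm, tsum_mul_left] at h1 h2
  exact ⟨fun n => (summable_mul_left_iff (Complex.exp_ne_zero _)).1 (h1 n), h2⟩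

/-- Summation by parts in the `n`-th row, using that the terms `(-1)^{ν - 1/2} q^{nν}` are in
geometric progression of ratio `-q^n`. It replaces the coefficient by its backward difference,
which, up to the jump of the sign function, is an integral of Gaussians. -/
lemma one_add_exp_mul_tsum_row {z : ℂ} {n : ℤ}
    (h : Summable fun j => (errCoeff z.im j : ℂ) * rowTerm z n j) :
    (1 + cexp (2 * π * I * n * z)) * ∑' j, (errCoeff z.im j : ℂ) * rowTerm z n j =
      2 * cexp (π * I * n * z) - 2 * √(2 * z.im) * ∑' j : ℤ,
        ((∫ s in (0 : ℝ)..1, Real.exp (-π * (((j : ℝ) + 1 / 2 - s) * √(2 * z.im)) ^ 2) : ℝ) : ℂ) *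
          rowTerm z n j := by
  have h1 : Summable fun j => (errCoeff z.im (j - 1) : ℂ) * rowTerm z n j := by
    have := (h.mul_left (-cexp (2 * π * I * n * z))).comp_injective
      (Equiv.subRight (1 : ℤ)).injective
    refine this.congr fun j => ?_
    have e := exp_mul_rowTerm z n (j - 1)
    rw [sub_add_cancel] at e
    simp only [Function.comp, Equiv.subRight_apply]
    linear_combination -(errCoeff z.im (j - 1) : ℂ) * e
  have h2 : cexp (2 * π * I * n * z) * ∑' j, (errCoeff z.im j : ℂ) * rowTerm z n j =
      -∑' j, (errCoeff z.im (j - 1) : ℂ) * rowTerm z n j := by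
    rw [← tsum_mul_left, ← tsum_neg, ← (Equiv.addRight (1 : ℤ)).tsum_eq
      fun j => -((errCoeff z.im (j - 1) : ℂ) * rowTerm z n j)]
    refine tsum_congr fun j => ?_
    simp only [Equiv.coe_addRight, add_sub_cancel_right]
    linear_combination (errCoeff z.im j : ℂ) * exp_mul_rowTerm z n j
  have h3 : Summable fun j : ℤ => (if j = 0 then (2 : ℂ) else 0) * rowTerm z n j :=
    summable_of_ne_finset_zero (s := {0}) fun j hj => by
      rw [if_neg (by simpa using hj), zero_mul]
  have h4 : ∀ j : ℤ, 2 * (√(2 * z.im) : ℂ) * (((∫ s in (0 : ℝ)..1,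
      Real.exp (-π * (((j : ℝ) + 1 / 2 - s) * √(2 * z.im)) ^ 2) : ℝ) : ℂ) * rowTerm z n j) =
      (if j = 0 then (2 : ℂ) else 0) * rowTerm z n j -
        ((errCoeff z.im j : ℂ) * rowTerm z n j - (errCoeff z.im (j - 1) : ℂ) * rowTerm z n j) := by
    intro j
    have e := congrArg (fun x : ℝ => (x : ℂ)) (errCoeff_sub_errCoeff z.im j)
    have e' : ((if j = 0 then 2 else 0 : ℝ) : ℂ) = if j = 0 then 2 else 0 := by
      split_ifs <;> simp
    push_cast at e ⊢
    rw [e'] at e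
    linear_combination rowTerm z n j * e
  have h5 : ∑' j : ℤ, (if j = 0 then (2 : ℂ) else 0) * rowTerm z n j =
      2 * cexp (π * I * n * z) := by
    rw [tsum_eq_single 0 fun j hj => by rw [if_neg hj, zero_mul], if_pos rfl, rowTerm]
    simp only [zpow_zero, one_mul, Int.cast_zero, zero_add]
    rw [show (2 * π * I * n * (1 / 2) * z : ℂ) = π * I * n * z by ring]
  rw [add_mul, one_mul, h2, ← tsum_mul_left, tsum_congr h4, h3.tsum_sub (h.sub h1),
    h.tsum_sub h1, h5]
  ring

/-- Poisson summation in the `n`-th row; on the dual side the half-integers `ξ = k + 1/2` occur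
because of the alternating sign. -/
lemma tsum_gaussian_mul_rowTerm {z : ℂ} (hz : 0 < z.im) (n : ℤ) (s : ℝ) :
    √(2 * z.im) * ∑' j : ℤ,
      (Real.exp (-π * (((j : ℝ) + 1 / 2 - s) * √(2 * z.im)) ^ 2) : ℂ) * rowTerm z n j =
    ∑' k : ℤ, cexp (π * I * (k + 1 / 2)) *
      (cexp (-π * (n * z - (k + 1 / 2)) ^ 2 / (2 * z.im)) *
        cexp (2 * π * I * (n * z - (k + 1 / 2)) * s)) := by
  have hy : (z.im : ℂ) ≠ 0 := by exact_mod_cast hz.ne'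
  have hre : 0 < (2 * z.im : ℂ).re := by simpa using hz
  have hc : (√(2 * z.im) : ℂ) = (2 * z.im : ℂ) ^ (1 / 2 : ℂ) := by
    rw [Real.sqrt_eq_rpow, Complex.ofReal_cpow (by positivity)]
    push_cast
    rfl
  have hc0 : (2 * z.im : ℂ) ^ (1 / 2 : ℂ) ≠ 0 := by
    simp [Complex.cpow_eq_zero_iff, hz.ne']
  have h := Complex.tsum_exp_neg_quadratic hre (I * n * z - 2 * z.im * (1 / 2 - s) - I / 2)
  have hl : ∀ j : ℤ, ((Real.exp (-π * (((j : ℝ) + 1 / 2 - s) * √(2 * z.im)) ^ 2) : ℝ) : ℂ) *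
      rowTerm z n j = cexp (π * I * n * z - 2 * π * z.im * (1 / 2 - s) ^ 2) *
        cexp (-π * (2 * z.im) * j ^ 2 +
          2 * π * (I * n * z - 2 * z.im * (1 / 2 - s) - I / 2) * j) := by
    intro j
    rw [rowTerm, ← exp_pi_mul_I_mul_int, mul_pow, Real.sq_sqrt (by positivity), Complex.ofReal_exp]
    simp only [← Complex.exp_add]
    refine Complex.exp_eq_exp_iff_exists_int.2 ⟨j, ?_⟩
    push_cast
    ring
  rw [tsum_congr hl, tsum_mul_left, h, hc, mul_left_comm, ← mul_assoc ((2 * z.im : ℂ) ^ (1 / 2 : ℂ)),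
    mul_one_div_cancel hc0, one_mul, ← tsum_mul_left]
  refine tsum_congr fun k => ?_
  simp only [← Complex.exp_add]
  congr 1
  field_simp
  ring_nf
  simp only [Complex.I_sq, Complex.I_pow_three, Complex.I_pow_four]
  ring

lemma hasSum_integral_of_norm_le {F : ℤ → ℝ → ℂ} (hF : ∀ n, Continuous (F n)) {u : ℤ → ℝ}
    (hu : Summable u) (h : ∀ n, ∀ s ∈ Set.Icc (0 : ℝ) 1, ‖F n s‖ ≤ u n) :
    HasSum (fun n => ∫ s in (0 : ℝ)..1, F n s) (∫ s in (0 : ℝ)..1, ∑' n, F n s) := by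
  have hmem : ∀ s ∈ Set.uIoc (0 : ℝ) 1, s ∈ Set.Icc (0 : ℝ) 1 := fun s hs => by
    rw [Set.uIoc_of_le zero_le_one] at hs
    exact Set.Ioc_subset_Icc_self hs
  refine intervalIntegral.hasSum_integral_of_dominated_convergence (fun n _ => u n)
    (fun n => (hF n).aestronglyMeasurable) (fun n => ?_) ?_ intervalIntegrable_const ?_
  · exact Eventually.of_forall fun s hs => h n s (hmem s hs)
  · exact Eventually.of_forall fun s hs => hu
  · exact Eventually.of_forall fun s hs =>
      (Summable.of_norm_bounded hu fun n => h n s (hmem s hs)).hasSum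

lemma norm_gaussian_mul_rowTerm_le {z : ℂ} (hz : 0 < z.im) (n j : ℤ) {s : ℝ}
    (hs : s ∈ Set.Icc (0 : ℝ) 1) :
    ‖(Real.exp (-π * (((j : ℝ) + 1 / 2 - s) * √(2 * z.im)) ^ 2) : ℂ) * rowTerm z n j‖ ≤
      Real.exp (2 * π * z.im) * Real.exp (2 * π * |(n : ℝ)| * z.im * |(j : ℝ) + 1 / 2| -
        π * z.im * ((j : ℝ) + 1 / 2) ^ 2) := by
  have e : (2 * π * I * n * (j + 1 / 2) * z : ℂ) = 2 * π * I * (n * (j + 1 / 2) : ℝ) * z := by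
    push_cast; ring
  rw [rowTerm, norm_mul, norm_mul, norm_neg_one_zpow, one_mul, e, norm_exp_two_pi_mul_I_mul,
    Complex.norm_real, Real.norm_of_nonneg (Real.exp_pos _).le, mul_pow,
    Real.sq_sqrt (by positivity), ← Real.exp_add, ← Real.exp_add]
  refine Real.exp_le_exp.2 ?_
  generalize (j : ℝ) + 1 / 2 = ν
  have h1 : -((n : ℝ) * ν) ≤ |(n : ℝ)| * |ν| := by
    rw [← abs_mul]; exact neg_le_abs _
  have h2 : ν ^ 2 ≤ 2 * (ν - s) ^ 2 + 2 := by
    nlinarith [sq_nonneg (ν - 2 * s), hs.1, hs.2]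
  have h3 := mul_pos Real.pi_pos hz
  nlinarith [mul_le_mul_of_nonneg_left h1 h3.le, mul_le_mul_of_nonneg_left h2 h3.le]

lemma norm_dual_gaussian_le {z : ℂ} (hz : 0 < z.im) (n k : ℤ) {s : ℝ}
    (hs : s ∈ Set.Icc (0 : ℝ) 1) :
    ‖cexp (π * I * (k + 1 / 2)) * (cexp (-π * (n * z - (k + 1 / 2)) ^ 2 / (2 * z.im)) *
        cexp (2 * π * I * (n * z - (k + 1 / 2)) * s))‖ ≤
      Real.exp (π * n ^ 2 * z.im / 2 + 2 * π * |(n : ℝ)| * z.im +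
        π * (n * z.re) ^ 2 / (2 * z.im)) *
        Real.exp (0 * |(k : ℝ) + 1 / 2| - π * (1 / (4 * z.im)) * ((k : ℝ) + 1 / 2) ^ 2) := by
  rw [← Complex.exp_add, ← Complex.exp_add, Complex.norm_exp, ← Real.exp_add]
  refine Real.exp_le_exp.2 ?_
  have hre : (π * I * (k + 1 / 2) + (-π * (n * z - (k + 1 / 2)) ^ 2 / (2 * z.im) +
      2 * π * I * (n * z - (k + 1 / 2)) * s) : ℂ).re =
      -(π * (n * z.re - (k + 1 / 2)) ^ 2 / (2 * z.im)) + π * n ^ 2 * z.im / 2 -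
        2 * π * n * z.im * s := by
    have hy : (z.im : ℂ) ≠ 0 := by exact_mod_cast hz.ne'
    have e : (π * I * (k + 1 / 2) + (-π * (n * z - (k + 1 / 2)) ^ 2 / (2 * z.im) +
      2 * π * I * (n * z - (k + 1 / 2)) * s) : ℂ) =
      ((-(π * (n * z.re - (k + 1 / 2)) ^ 2 / (2 * z.im)) + π * n ^ 2 * z.im / 2 -
        2 * π * n * z.im * s : ℝ) : ℂ) + ((π * (k + 1 / 2) - π * n * (n * z.re - (k + 1 / 2)) +
          2 * π * (n * z.re - (k + 1 / 2)) * s : ℝ) : ℂ) * I := by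
      have hz' : z = z.re + z.im * I := (Complex.re_add_im z).symm
      generalize z.re = x at *
      generalize z.im = y at *
      subst hz'
      push_cast
      field_simp
      ring_nf
      simp only [Complex.I_sq]
      ring
    rw [e, Complex.add_re, Complex.ofReal_re, Complex.re_ofReal_mul, Complex.I_re, mul_zero,
      add_zero]
  rw [hre]
  generalize (k : ℝ) + 1 / 2 = ν
  have h1 : -((n : ℝ) * s) ≤ |(n : ℝ)| := by
    have := mul_le_mul_of_nonneg_left hs.2 (abs_nonneg (n : ℝ))
    have h := mul_le_mul_of_nonneg_right (neg_le_abs (n : ℝ)) hs.1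
    linarith
  have h2 : π * (1 / (4 * z.im)) * ν ^ 2 ≤
      π * (n * z.re - ν) ^ 2 / (2 * z.im) + π * (n * z.re) ^ 2 / (2 * z.im) := by
    have : π * (n * z.re - ν) ^ 2 / (2 * z.im) + π * (n * z.re) ^ 2 / (2 * z.im) -
        π * (1 / (4 * z.im)) * ν ^ 2 = π / (4 * z.im) * (2 * (n * z.re) - ν) ^ 2 := by
      field_simp
      ring
    have h3 : 0 ≤ π / (4 * z.im) * (2 * (n * z.re) - ν) ^ 2 := by positivity
    linarith
  have h3 := mul_pos Real.pi_pos hz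
  nlinarith [mul_le_mul_of_nonneg_left h1 h3.le]

lemma int_mul_sub_half_ne_zero {z : ℂ} (hz : 0 < z.im) (n k : ℤ) :
    (n : ℂ) * z - (k + 1 / 2) ≠ 0 := by
  intro h
  have him := congrArg Complex.im h
  have hre := congrArg Complex.re h
  simp at him hre
  rcases him with h1 | h1
  · rw [h1] at hre
    refine int_add_half_ne_zero k ?_
    simp at hre
    linarith
  · exact hz.ne' h1

/-- The `n`-th row evaluated by Poisson summation: integrating the exponential in `s` over `[0, 1]`
produces the denominators of the lattice sum and a factor `1 + q^n` which cancels. -/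
lemma tsum_row_eq {z : ℂ} (hz : 0 < z.im) {n : ℤ}
    (h : Summable fun j => (errCoeff z.im j : ℂ) * rowTerm z n j) :
    ∑' j, (errCoeff z.im j : ℂ) * rowTerm z n j =
      2 * cexp (π * I * n * z) / (1 + cexp (2 * π * I * n * z)) + 1 / (π * I) *
        ∑' k : ℤ, cexp (π * I * (k + 1 / 2)) *
          cexp (-π * (n * z - (k + 1 / 2)) ^ 2 / (2 * z.im)) / (n * z - (k + 1 / 2)) := by
  have hπ : (π : ℂ) ≠ 0 := by exact_mod_cast Real.pi_ne_zero
  have hq := one_add_exp_ne_zero hz n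
  have h1 := one_add_exp_mul_tsum_row h
  have hl := hasSum_integral_of_norm_le (F := fun j s =>
    (Real.exp (-π * (((j : ℝ) + 1 / 2 - s) * √(2 * z.im)) ^ 2) : ℂ) * rowTerm z n j)
    (fun j => by fun_prop) ((summable_exp_linear_sub_gaussian (2 * π * |(n : ℝ)| * z.im) hz).mul_left
      (Real.exp (2 * π * z.im))) (fun j s hs => norm_gaussian_mul_rowTerm_le hz n j hs)
  have hr := hasSum_integral_of_norm_le (F := fun k s => cexp (π * I * (k + 1 / 2)) *
      (cexp (-π * (n * z - (k + 1 / 2)) ^ 2 / (2 * z.im)) *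
        cexp (2 * π * I * (n * z - (k + 1 / 2)) * s)))
    (fun k => by fun_prop)
    ((summable_exp_linear_sub_gaussian 0 (y := 1 / (4 * z.im)) (by positivity)).mul_left _)
    (fun k s hs => norm_dual_gaussian_le hz n k hs)
  have hint : ∀ k : ℤ, (∫ s in (0 : ℝ)..1, cexp (π * I * (k + 1 / 2)) *
      (cexp (-π * (n * z - (k + 1 / 2)) ^ 2 / (2 * z.im)) *
        cexp (2 * π * I * (n * z - (k + 1 / 2)) * s))) =
      -(1 + cexp (2 * π * I * n * z)) / (2 * π * I) * (cexp (π * I * (k + 1 / 2)) *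
          cexp (-π * (n * z - (k + 1 / 2)) ^ 2 / (2 * z.im)) / (n * z - (k + 1 / 2))) := by
    intro k
    have hw := int_mul_sub_half_ne_zero hz n k
    have he : cexp (2 * π * I * (n * z - (k + 1 / 2))) = -cexp (2 * π * I * n * z) := by
      rw [neg_eq_neg_one_mul, ← Complex.exp_pi_mul_I, ← Complex.exp_add]
      refine Complex.exp_eq_exp_iff_exists_int.2 ⟨-k - 1, ?_⟩
      push_cast
      ring
    rw [intervalIntegral.integral_const_mul, intervalIntegral.integral_const_mul,
      integral_exp_mul_complex (mul_ne_zero (by simp [hπ]) hw)]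
    simp only [Complex.ofReal_one, Complex.ofReal_zero, mul_one, mul_zero, Complex.exp_zero, he]
    field_simp
    ring
  have key : √(2 * z.im) * ∑' j : ℤ, ((∫ s in (0 : ℝ)..1,
      Real.exp (-π * (((j : ℝ) + 1 / 2 - s) * √(2 * z.im)) ^ 2) : ℝ) : ℂ) * rowTerm z n j =
      -(1 + cexp (2 * π * I * n * z)) / (2 * π * I) * ∑' k : ℤ, cexp (π * I * (k + 1 / 2)) *
          cexp (-π * (n * z - (k + 1 / 2)) ^ 2 / (2 * z.im)) / (n * z - (k + 1 / 2)) := by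
    rw [← tsum_mul_left (a := -(1 + cexp (2 * π * I * n * z)) / (2 * π * I)), ← tsum_congr hint,
      hr.tsum_eq, ← intervalIntegral.integral_congr fun s _ => tsum_gaussian_mul_rowTerm hz n s,
      intervalIntegral.integral_const_mul, ← hl.tsum_eq]
    congr 1
    refine tsum_congr fun j => ?_
    rw [intervalIntegral.integral_mul_const, ← intervalIntegral.integral_ofReal]
  rw [mul_assoc 2 (√(2 * z.im) : ℂ), key] at h1
  generalize (∑' k : ℤ, cexp (π * I * (k + 1 / 2)) *
          cexp (-π * (n * z - (k + 1 / 2)) ^ 2 / (2 * z.im)) / (n * z - (k + 1 / 2))) = W at h1 ⊢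
  refine mul_left_cancel₀ hq (h1.trans ?_)
  field_simp
  ring

/-- For `w = nz - ξ` with `ξ = k + 1/2` one has
`i n² z - w² / (2 Im z) = i n ξ - |w|² / (2 Im z)`, and `i n ξ` goes into the unitary factor of the
lattice sum. -/
lemma exp_mul_dual_term {z : ℂ} (hz : 0 < z.im) (n k : ℤ) :
    cexp (π * I * n ^ 2 * z) * (cexp (π * I * (k + 1 / 2)) *
      cexp (-π * (n * z - (k + 1 / 2)) ^ 2 / (2 * z.im)) / (n * z - (k + 1 / 2))) =
      -I * latticeTerm 0 (1 / 2) z (n, -1 - k) := by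
  have hy : (z.im : ℂ) ≠ 0 := by exact_mod_cast hz.ne'
  have hI : (-I : ℂ) = cexp (-(π * I / 2)) := by
    rw [Complex.exp_neg, mul_div_right_comm, Complex.exp_pi_div_two_mul_I, Complex.inv_I]
  have hw : ((n : ℂ) + (0 : ℝ)) * z + (((-1 - k : ℤ) : ℂ) + (1 / 2 : ℝ)) = n * z - (k + 1 / 2) := by
    push_cast; ring
  set w := (n : ℂ) * z - (k + 1 / 2) with hwdef
  have hconj : ((‖w‖ ^ 2 : ℝ) : ℂ) = w * (w - 2 * I * n * z.im) := by
    have h1 : (starRingEnd ℂ) w = w - 2 * I * n * z.im := by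
      apply Complex.ext <;> simp [hwdef]
      ring
    rw [← h1, Complex.mul_conj, Complex.normSq_eq_norm_sq]
  rw [latticeTerm, ← exp_pi_mul_I_mul_int, hI]
  simp only [hw]
  rw [mul_div_assoc', mul_div_assoc', Complex.ofReal_exp]
  congr 1
  simp only [← Complex.exp_add]
  refine Complex.exp_eq_exp_iff_exists_int.2 ⟨k + 1 + n * k, ?_⟩
  have hexp : ((-π * ‖w‖ ^ 2 / (2 * z.im) : ℝ) : ℂ) = -π * w ^ 2 / (2 * z.im) + π * I * n * w := by
    have : ((-π * ‖w‖ ^ 2 / (2 * z.im) : ℝ) : ℂ) = -π * ((‖w‖ ^ 2 : ℝ) : ℂ) / (2 * z.im) := by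
      push_cast; ring
    rw [this, hconj]
    field_simp
    ring
  rw [hexp, hwdef]
  push_cast
  ring

/-- The sum of all rows: up to a multiple of the lattice sum, the product of `R(0; τ)` and the theta
function is twice the Lerch sum, which is exactly what the completion cancels. -/
lemma errSum_mul_theta_eq (τ : UpperHalfPlane) :
    errSum 0 τ * -thetaChar 0 (1 / 2) τ =
      2 * lerchSum τ - 1 / π * latticeSum 0 (1 / 2) τ := by
  have hz : 0 < (τ : ℂ).im := τ.im_pos
  have hπ : (π : ℂ) ≠ 0 := by exact_mod_cast Real.pi_ne_zero
  obtain ⟨h1, h2⟩ := hasSum_errSum_mul_theta hz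
  have hL : Summable (latticeTerm 0 (1 / 2) τ) := by
    simpa using summable_latticeTerm 0 1 τ
  have h3 : ∀ n : ℤ, cexp (π * I * n ^ 2 * τ) *
      ∑' j, (errCoeff (τ : ℂ).im j : ℂ) * rowTerm τ n j =
      2 * lerchTerm τ n - 1 / π * ∑' l, latticeTerm 0 (1 / 2) τ (n, l) := by
    intro n
    rw [tsum_row_eq hz (h1 n), mul_add, mul_left_comm, ← tsum_mul_left,
      tsum_congr (exp_mul_dual_term hz n), tsum_mul_left,
      ← (Equiv.subLeft (-1 : ℤ)).tsum_eq fun l => latticeTerm 0 (1 / 2) τ (n, l), lerchTerm]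
    simp only [Equiv.subLeft_apply]
    have e : cexp (π * I * ((n : ℂ) ^ 2 + n) * τ) =
        cexp (π * I * n ^ 2 * τ) * cexp (π * I * n * τ) := by
      rw [← Complex.exp_add]; ring_nf
    rw [e]
    field_simp
    ring
  have h4 := ((summable_lerchTerm hz).hasSum.mul_left 2).sub (hL.prod.hasSum.mul_left (1 / (π : ℂ)))
  simp only [h3] at h2
  rw [h2.unique h4, latticeSum, lerchSum, hL.tsum_prod]

/-- The completed function is the quotient of the lattice sum by the theta function. -/
theorem h1_eq (τ : UpperHalfPlane) :
    h1 τ = I / (2 * π) * (latticeSum 0 (1 / 2) τ / thetaChar 0 (1 / 2) τ) := by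
  have hθ := thetaChar_zero_half_ne_zero τ
  have hπ : (π : ℂ) ≠ 0 := by exact_mod_cast Real.pi_ne_zero
  have h := errSum_mul_theta_eq τ
  rw [h1, muTilde, mu_half_half, sub_self, R_zero_eq]
  field_simp
  field_simp at h
  linear_combination -h

/-! ### Differentiability of the series -/

lemma isOpen_lt_im (y : ℝ) : IsOpen {z : ℂ | y < z.im} :=
  isOpen_lt continuous_const Complex.continuous_im

lemma isPreconnected_lt_im (y : ℝ) : IsPreconnected {z : ℂ | y < z.im} :=
  (convex_halfSpace_im_gt y).isPreconnected

lemma norm_exp_sq_le {y : ℝ} {z : ℂ} (hz : y < z.im) (ν : ℝ) :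
    ‖cexp (π * I * ν ^ 2 * z)‖ ≤ Real.exp (-(π * y * ν ^ 2)) := by
  rw [norm_exp_pi_mul_I_sq]
  refine Real.exp_le_exp.2 (neg_le_neg ?_)
  have := Real.pi_pos
  gcongr

/-- The unary theta series `∑ ν^{2k+1} (-1)^{ν - 1/2} e^{πiν²z}` over `ν = n + 1/2`. -/
def shadow (k : ℕ) (z : ℂ) : ℂ :=
  ∑' n : ℤ, (((n : ℝ) + 1 / 2 : ℝ) : ℂ) ^ (2 * k + 1) * (-1) ^ n *
    cexp (π * I * (((n : ℝ) + 1 / 2 : ℝ) : ℂ) ^ 2 * z)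

lemma norm_shadow_term_le (k : ℕ) {y : ℝ} {z : ℂ} (hz : y < z.im) (n : ℤ) :
    ‖(((n : ℝ) + 1 / 2 : ℝ) : ℂ) ^ k * (-1) ^ n *
      cexp (π * I * (((n : ℝ) + 1 / 2 : ℝ) : ℂ) ^ 2 * z)‖ ≤
      |(n : ℝ) + 1 / 2| ^ k * Real.exp (-(π * y * ((n : ℝ) + 1 / 2) ^ 2)) := by
  rw [norm_mul, norm_mul, norm_neg_one_zpow, mul_one, norm_pow, Complex.norm_real,
    Real.norm_eq_abs]
  gcongr
  exact norm_exp_sq_le hz _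

lemma summable_shadow_term (k : ℕ) {z : ℂ} (hz : 0 < z.im) :
    Summable fun n : ℤ => (((n : ℝ) + 1 / 2 : ℝ) : ℂ) ^ k * (-1) ^ n *
      cexp (π * I * (((n : ℝ) + 1 / 2 : ℝ) : ℂ) ^ 2 * z) :=
  Summable.of_norm_bounded (summable_pow_mul_gaussian k (half_pos hz))
    (norm_shadow_term_le k (half_lt_self hz))

lemma hasDerivAt_shadow (k : ℕ) {z : ℂ} (hz : 0 < z.im) :
    HasDerivAt (shadow k) (π * I * shadow (k + 1) z) z := by
  have hy := half_pos hz
  have h := hasDerivAt_tsum_of_isPreconnected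
    (g := fun (n : ℤ) (z : ℂ) => (((n : ℝ) + 1 / 2 : ℝ) : ℂ) ^ (2 * k + 1) * (-1) ^ n *
      cexp (π * I * (((n : ℝ) + 1 / 2 : ℝ) : ℂ) ^ 2 * z))
    (g' := fun (n : ℤ) (z : ℂ) => π * I * ((((n : ℝ) + 1 / 2 : ℝ) : ℂ) ^ (2 * (k + 1) + 1) *
      (-1) ^ n * cexp (π * I * (((n : ℝ) + 1 / 2 : ℝ) : ℂ) ^ 2 * z)))
    ((summable_pow_mul_gaussian (2 * (k + 1) + 1) hy).mul_left π) (isOpen_lt_im (z.im / 2))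
    (isPreconnected_lt_im _) (fun n w _ => ?_) (fun n w hw => ?_) (half_lt_self hz)
    (summable_shadow_term _ hz) (half_lt_self hz)
  · rw [tsum_mul_left] at h
    exact h
  · have h1 := (((hasDerivAt_id w).const_mul (π * I * (((n : ℝ) + 1 / 2 : ℝ) : ℂ) ^ 2)).cexp).const_mul
      ((((n : ℝ) + 1 / 2 : ℝ) : ℂ) ^ (2 * k + 1) * (-1) ^ n)
    refine h1.congr_deriv ?_
    simp only [id]
    ring
  · rw [norm_mul, norm_mul, Complex.norm_I, mul_one, Complex.norm_real,
      Real.norm_of_nonneg Real.pi_pos.le]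
    exact mul_le_mul_of_nonneg_left (norm_shadow_term_le _ hw n) Real.pi_pos.le

/-- The imaginary part as an `ℝ`-linear map with complex values. -/
def imC : ℂ →L[ℝ] ℂ := Complex.ofRealCLM.comp Complex.imCLM

lemma norm_imC_le : ‖imC‖ ≤ 1 :=
  ContinuousLinearMap.opNorm_le_bound _ zero_le_one fun z => by
    simpa [imC] using Complex.abs_im_le_norm z

/-- The part of the derivative of `errSum k` in which the error function is differentiated; its
dependence on `z` is antiholomorphic up to a power of `Im z`. -/
def errDeriv (k : ℕ) (z : ℂ) : ℂ :=
  ((-2 / √(2 * z.im) : ℝ) : ℂ) * (starRingEnd ℂ) (shadow k z)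

lemma hasDerivAt_errCoeff {y : ℝ} (hy : 0 < y) (n : ℤ) :
    HasDerivAt (fun y => errCoeff y n)
      (-2 / √(2 * y) * ((n : ℝ) + 1 / 2) * Real.exp (-(2 * π * y * ((n : ℝ) + 1 / 2) ^ 2))) y := by
  have h0 : 2 * y ≠ 0 := by positivity
  have h1 := (((hasDerivAt_id y).const_mul 2).sqrt h0).const_mul ((n : ℝ) + 1 / 2)
  have h2 := ((hasDerivAt_errE _).comp y h1).const_sub (Real.sign ((n : ℝ) + 1 / 2))
  refine h2.congr_deriv ?_
  simp only [id]
  rw [mul_pow, Real.sq_sqrt (by positivity)]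
  have : -π * (((n : ℝ) + 1 / 2) ^ 2 * (2 * y)) = -(2 * π * y * ((n : ℝ) + 1 / 2) ^ 2) := by ring
  rw [this]
  field_simp

lemma conj_shadow_term (k : ℕ) (z : ℂ) (n : ℤ) :
    (starRingEnd ℂ) ((((n : ℝ) + 1 / 2 : ℝ) : ℂ) ^ k * (-1) ^ n *
      cexp (π * I * (((n : ℝ) + 1 / 2 : ℝ) : ℂ) ^ 2 * z)) =
    (((n : ℝ) + 1 / 2 : ℝ) : ℂ) ^ k * (-1) ^ n *
      ((Real.exp (-(2 * π * z.im * ((n : ℝ) + 1 / 2) ^ 2)) : ℂ) *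
        cexp (-(π * I * (((n : ℝ) + 1 / 2 : ℝ) : ℂ) ^ 2 * z))) := by
  have h : (starRingEnd ℂ) z = z - 2 * I * z.im := by
    apply Complex.ext <;> simp
    ring
  rw [Complex.ofReal_exp, ← Complex.exp_add]
  simp only [map_mul, map_pow, map_zpow₀, map_neg, map_one, Complex.conj_ofReal, ← Complex.exp_conj,
    Complex.conj_I, h]
  congr 2
  push_cast
  ring_nf
  simp only [Complex.I_sq]
  ring

lemma hasFDerivAt_errTerm (k : ℕ) {z : ℂ} (hz : 0 < z.im) (n : ℤ) :
    HasFDerivAt (fun z => errTerm k z n)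
      ((-(π * I) * errTerm (k + 1) z n) • ContinuousLinearMap.id ℝ ℂ +
        (((-2 / √(2 * z.im) : ℝ) : ℂ) * (starRingEnd ℂ) ((((n : ℝ) + 1 / 2 : ℝ) : ℂ) ^ (2 * k + 1) *
          (-1) ^ n * cexp (π * I * (((n : ℝ) + 1 / 2 : ℝ) : ℂ) ^ 2 * z))) • imC) z := by
  have h1 : HasFDerivAt (fun z : ℂ => (errCoeff z.im n : ℂ)) _ z :=
    (hasDerivAt_errCoeff hz n).ofReal_comp.hasFDerivAt.comp z Complex.imCLM.hasFDerivAt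
  have h2 : HasFDerivAt (fun z : ℂ => cexp (-(π * I * (((n : ℝ) + 1 / 2 : ℝ) : ℂ) ^ 2 * z))) _ z :=
    (((hasDerivAt_id z).const_mul
      (π * I * (((n : ℝ) + 1 / 2 : ℝ) : ℂ) ^ 2)).neg.cexp).hasFDerivAt.restrictScalars ℝ
  have h3 := (h1.mul h2).const_mul ((((n : ℝ) + 1 / 2 : ℝ) : ℂ) ^ (2 * k) * (-1) ^ n)
  refine (h3.congr_fderiv ?_).congr_of_eventuallyEq (Eventually.of_forall fun w => ?_)
  · ext v
    rw [conj_shadow_term]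
    simp [imC, errTerm]
    ring
  · simp only [errTerm, Pi.mul_apply]
    ring

lemma hasFDerivAt_errSum (k : ℕ) {z : ℂ} (hz : 0 < z.im) :
    HasFDerivAt (errSum k) ((-(π * I) * errSum (k + 1) z) • ContinuousLinearMap.id ℝ ℂ +
      errDeriv k z • imC) z := by
  have hy := half_pos hz
  have hu := ((summable_pow_mul_gaussian (2 * (k + 1)) hy).mul_left π).add
    ((summable_pow_mul_gaussian (2 * k + 1) hy).mul_left (2 / √(2 * (z.im / 2))))
  have h := hasFDerivAt_tsum_of_isPreconnected hu (isOpen_lt_im (z.im / 2))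
    (isPreconnected_lt_im _) (fun n w hw => hasFDerivAt_errTerm k (hy.trans hw) n)
    (fun n w hw => ?_) (half_lt_self hz) (summable_norm_errTerm k hz).of_norm (half_lt_self hz)
  · refine h.congr_fderiv ?_
    have hs1 : Summable fun n => -(π * I) * errTerm (k + 1) z n :=
      (summable_norm_errTerm (k + 1) hz).of_norm.mul_left _
    have hs2 : Summable fun n : ℤ => ((-2 / √(2 * z.im) : ℝ) : ℂ) * (starRingEnd ℂ)
        ((((n : ℝ) + 1 / 2 : ℝ) : ℂ) ^ (2 * k + 1) *
          (-1) ^ n * cexp (π * I * (((n : ℝ) + 1 / 2 : ℝ) : ℂ) ^ 2 * z)) :=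
      ((Complex.conjCLE.summable).2 (summable_shadow_term (2 * k + 1) hz)).mul_left _
    rw [(hs1.smul_const _).tsum_add (hs2.smul_const _), hs1.tsum_smul_const, hs2.tsum_smul_const,
      tsum_mul_left, tsum_mul_left, errDeriv, shadow, Complex.conj_tsum, errSum]
  · have hw' : z.im / 2 < w.im := hw
    refine (norm_add_le _ _).trans (add_le_add ?_ ?_)
    · rw [norm_smul, norm_mul, norm_neg, norm_mul, Complex.norm_I, mul_one, Complex.norm_real,
        Real.norm_of_nonneg Real.pi_pos.le]
      refine (mul_le_of_le_one_right (by positivity) ContinuousLinearMap.norm_id_le).trans ?_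
      refine mul_le_mul_of_nonneg_left ((norm_errTerm_le (k + 1) (hy.trans hw') n).trans ?_)
        Real.pi_pos.le
      have := Real.pi_pos
      gcongr
    · rw [norm_smul, norm_mul, Complex.norm_real, RCLike.norm_conj, Real.norm_eq_abs, abs_div,
        abs_neg, abs_of_pos (two_pos : (0 : ℝ) < 2), abs_of_nonneg (Real.sqrt_nonneg _)]
      refine (mul_le_of_le_one_right (by positivity) norm_imC_le).trans ?_
      have h0 : 0 < √(2 * (z.im / 2)) := Real.sqrt_pos.2 (by positivity)
      gcongr
      exact norm_shadow_term_le _ hw' n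

/-! ### Smoothness -/

lemma contDiffOn_of_differentiableOn {f : ℂ → ℂ} {n : WithTop ℕ∞}
    (hf : DifferentiableOn ℂ f {z | 0 < z.im}) : ContDiffOn ℝ n f {z | 0 < z.im} :=
  (hf.contDiffOn (isOpen_lt_im 0)).restrict_scalars ℝ

lemma contDiffOn_errDeriv (k : ℕ) {n : WithTop ℕ∞} :
    ContDiffOn ℝ n (errDeriv k) {z | 0 < z.im} := by
  have h1 : ContDiffOn ℝ n (shadow k) {z | 0 < z.im} :=
    contDiffOn_of_differentiableOn fun z hz =>
      (hasDerivAt_shadow k hz).differentiableAt.differentiableWithinAt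
  have h2 : ContDiffOn ℝ n (fun z : ℂ => -2 / √(2 * z.im)) {z | 0 < z.im} := by
    refine ContDiffOn.div contDiffOn_const (ContDiffOn.sqrt ?_ fun z hz => ?_) fun z hz => ?_
    · exact contDiffOn_const.mul Complex.imCLM.contDiff.contDiffOn
    · have : 0 < z.im := hz
      positivity
    · have : 0 < z.im := hz
      positivity
  exact (Complex.ofRealCLM.contDiff.comp_contDiffOn h2).mul
    (Complex.conjCLE.contDiff.comp_contDiffOn h1)

/-- Differentiating `errSum k` produces `errSum (k + 1)` and a smooth function, so that all the
series `errSum k` are smooth by simultaneous induction. -/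
lemma contDiffOn_errSum (n k : ℕ) : ContDiffOn ℝ n (errSum k) {z | 0 < z.im} := by
  induction n generalizing k with
  | zero =>
    exact contDiffOn_zero.2 fun z hz => (hasFDerivAt_errSum k hz).continuousAt.continuousWithinAt
  | succ n ih =>
    push_cast
    refine (contDiffOn_succ_iff_fderiv_of_isOpen (isOpen_lt_im 0)).2
      ⟨fun z hz => (hasFDerivAt_errSum k hz).differentiableAt.differentiableWithinAt,
        fun h => by simp at h, ?_⟩
    refine ContDiffOn.congr ?_ fun z hz => (hasFDerivAt_errSum k hz).fderiv
    exact ((contDiffOn_const.mul (ih (k + 1))).smul contDiffOn_const).add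
      ((contDiffOn_errDeriv k).smul contDiffOn_const)

lemma differentiableOn_lerchSum : DifferentiableOn ℂ lerchSum {z | 0 < z.im} := by
  intro z hz
  have hy : 0 < z.im / 2 := half_pos hz
  have hu := (summable_pow_mul_gaussian 0 hy).mul_left
    (Real.exp (π * (z.im / 2) / 4) / (1 - Real.exp (-(2 * π * (z.im / 2)))))
  have h := differentiableOn_tsum_of_summable_norm (F := fun n z => lerchTerm z n) hu
    (fun n w hw => ?_) (isOpen_lt_im (z.im / 2)) fun n w hw => ?_
  · exact (h.differentiableAt
      ((isOpen_lt_im _).mem_nhds (show z.im / 2 < z.im from half_lt_self hz))).differentiableWithinAt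
  · have h1 := one_add_exp_ne_zero (hy.trans hw) n
    unfold lerchTerm
    refine DifferentiableAt.differentiableWithinAt ?_
    exact DifferentiableAt.div (by fun_prop) (by fun_prop) h1
  · simpa using norm_lerchTerm_le hy (le_of_lt hw) n

/-- The holomorphic part `μ(1/2, 1/2; z)` of `h₁`. -/
def holPart (z : ℂ) : ℂ := I / thetaChar 0 (1 / 2) z * lerchSum z

lemma differentiableOn_holPart : DifferentiableOn ℂ holPart {z | 0 < z.im} := by
  refine DifferentiableOn.mul (DifferentiableOn.div (by fun_prop) (fun z hz =>
    (differentiableAt_thetaChar 0 (1 / 2) hz).differentiableWithinAt) fun z hz => ?_)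
    differentiableOn_lerchSum
  exact thetaChar_zero_half_ne_zero ⟨z, hz⟩

lemma h1_ofComplex {z : ℂ} (hz : 0 < z.im) :
    h1 (UpperHalfPlane.ofComplex z) = holPart z + I / 2 * errSum 0 z := by
  rw [h1, muTilde, mu_half_half, sub_self, R_zero_eq, UpperHalfPlane.ofComplex_apply_of_im_pos hz,
    holPart]

lemma contDiffOn_h1 :
    ContDiffOn ℝ ∞ (fun z : ℂ => h1 (UpperHalfPlane.ofComplex z)) {z : ℂ | 0 < z.im} := by
  refine ContDiffOn.congr ?_ fun z hz => h1_ofComplex hz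
  exact (contDiffOn_of_differentiableOn differentiableOn_holPart).add
    (contDiffOn_const.mul (contDiffOn_infty.2 fun n => contDiffOn_errSum n 0))

/-! ### Harmonicity -/

lemma partialX_eq {F : ℂ → ℂ} {z a b : ℂ}
    (h : HasFDerivAt F (a • ContinuousLinearMap.id ℝ ℂ + b • imC) z) : partialX F z = a := by
  rw [partialX, h.fderiv]
  simp [imC]

lemma partialY_eq {F : ℂ → ℂ} {z a b : ℂ}
    (h : HasFDerivAt F (a • ContinuousLinearMap.id ℝ ℂ + b • imC) z) :
    partialY F z = a * I + b := by
  rw [partialY, h.fderiv]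
  simp [imC]

lemma hasFDerivAt_imC_of_hasDerivAt {F : ℂ → ℂ} {z a : ℂ} (h : HasDerivAt F a z) :
    HasFDerivAt F (a • ContinuousLinearMap.id ℝ ℂ + (0 : ℂ) • imC) z := by
  refine (h.hasFDerivAt.restrictScalars ℝ).congr_fderiv ?_
  ext v
  simp [mul_comm]

lemma partialX_congr {F G : ℂ → ℂ} (h : ∀ z : ℂ, 0 < z.im → F z = G z) {z : ℂ} (hz : 0 < z.im) :
    partialX F z = partialX G z := by
  rw [partialX, partialX, Filter.EventuallyEq.fderiv_eq]
  filter_upwards [(isOpen_lt_im 0).mem_nhds hz] with w hw using h w hw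

lemma partialY_congr {F G : ℂ → ℂ} (h : ∀ z : ℂ, 0 < z.im → F z = G z) {z : ℂ} (hz : 0 < z.im) :
    partialY F z = partialY G z := by
  rw [partialY, partialY, Filter.EventuallyEq.fderiv_eq]
  filter_upwards [(isOpen_lt_im 0).mem_nhds hz] with w hw using h w hw

/-- The derivative of `errDeriv 0` in the direction of `y`: the conjugate of a holomorphic function
is differentiated as such, and the power `y^{-1/2}` contributes the factor `-1/(2y)`. -/
lemma partialY_errDeriv {z : ℂ} (hz : 0 < z.im) :
    DifferentiableAt ℝ (errDeriv 0) z ∧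
      partialY (errDeriv 0) z = -(errDeriv 0 z / (2 * z.im)) - π * errDeriv 1 z := by
  have hy : 0 < √(2 * z.im) := Real.sqrt_pos.2 (by positivity)
  have hd : HasDerivAt (fun y : ℝ => -2 / √(2 * y)) (2 / √(2 * z.im) / (2 * z.im)) z.im := by
    have h0 : 2 * z.im ≠ 0 := by positivity
    have h := ((((hasDerivAt_id z.im).const_mul 2).sqrt h0).inv hy.ne').const_mul (-2)
    refine h.congr_deriv ?_
    simp only [id, mul_one]
    have := Real.sq_sqrt (show 0 ≤ 2 * z.im by positivity)
    rw [this]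
    field_simp
  have h1 : HasFDerivAt (fun z : ℂ => ((-2 / √(2 * z.im) : ℝ) : ℂ)) _ z :=
    hd.ofReal_comp.hasFDerivAt.comp z Complex.imCLM.hasFDerivAt
  have h2 : HasFDerivAt (fun z : ℂ => (starRingEnd ℂ) (shadow 0 z)) _ z :=
    Complex.conjCLE.hasFDerivAt.comp z ((hasDerivAt_shadow 0 hz).hasFDerivAt.restrictScalars ℝ)
  have h3 := h1.mul h2
  refine ⟨h3.differentiableAt, ?_⟩
  rw [partialY]
  have h4 : fderiv ℝ (errDeriv 0) z = _ := h3.fderiv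
  rw [h4]
  simp [errDeriv]
  have hy' : (z.im : ℂ) ≠ 0 := by exact_mod_cast hz.ne'
  have hy'' : (√(2 * z.im) : ℂ) ≠ 0 := by exact_mod_cast hy.ne'
  field_simp
  ring_nf
  simp only [Complex.I_sq]
  ring

/-- In `Δ_{1/2} h₁` everything holomorphic and every `errSum` cancels; what remains is the identity
`∂_y s = -s / (2y) - π s₁` for the derivatives `s = errDeriv 0` and `s₁ = errDeriv 1`. -/
theorem hypLaplacian_h1 (τ : UpperHalfPlane) : hypLaplacian 1 h1 τ = 0 := by
  have hz : 0 < (τ : ℂ).im := τ.im_pos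
  rw [hypLaplacian]
  generalize (τ : ℂ) = z at hz ⊢
  have hU : ∀ {w : ℂ}, 0 < w.im → {w : ℂ | 0 < w.im} ∈ 𝓝 w := fun hw =>
    (isOpen_lt_im 0).mem_nhds hw
  have hd1 : DifferentiableOn ℂ (deriv holPart) {w | 0 < w.im} :=
    differentiableOn_holPart.deriv (isOpen_lt_im 0)
  have hF : ∀ {w : ℂ}, 0 < w.im → HasFDerivAt (fun w => holPart w + I / 2 * errSum 0 w)
      ((deriv holPart w + π / 2 * errSum 1 w) • ContinuousLinearMap.id ℝ ℂ +
        (I / 2 * errDeriv 0 w) • imC) w := fun {w} hw => by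
    have h1 := hasFDerivAt_imC_of_hasDerivAt
      (differentiableOn_holPart.differentiableAt (hU hw)).hasDerivAt
    have h2 := (hasFDerivAt_errSum 0 hw).const_mul (I / 2)
    refine (h1.add h2).congr_fderiv ?_
    ext v
    simp
    linear_combination (-(π * errSum 1 w * v) / 2) * Complex.I_sq
  have hG : HasFDerivAt (fun w => deriv holPart w + π / 2 * errSum 1 w)
      ((deriv (deriv holPart) z - π ^ 2 * I / 2 * errSum 2 z) • ContinuousLinearMap.id ℝ ℂ +
        (π / 2 * errDeriv 1 z) • imC) z := by
    have h1 := hasFDerivAt_imC_of_hasDerivAt (hd1.differentiableAt (hU hz)).hasDerivAt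
    have h2 := (hasFDerivAt_errSum 1 hz).const_mul (π / 2 : ℂ)
    refine (h1.add h2).congr_fderiv ?_
    ext v
    simp
    ring
  have hX : ∀ w : ℂ, 0 < w.im → partialX (fun z => h1 (UpperHalfPlane.ofComplex z)) w =
      deriv holPart w + π / 2 * errSum 1 w := fun w hw => by
    rw [partialX_congr (fun z hz => h1_ofComplex hz) hw, partialX_eq (hF hw)]
  have hY : ∀ w : ℂ, 0 < w.im → partialY (fun z => h1 (UpperHalfPlane.ofComplex z)) w =
      (deriv holPart w + π / 2 * errSum 1 w) * I + I / 2 * errDeriv 0 w := fun w hw => by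
    rw [partialY_congr (fun z hz => h1_ofComplex hz) hw, partialY_eq (hF hw)]
  obtain ⟨hs1, hs2⟩ := partialY_errDeriv hz
  have hYY : partialY (partialY fun z => h1 (UpperHalfPlane.ofComplex z)) z =
      ((deriv (deriv holPart) z - π ^ 2 * I / 2 * errSum 2 z) * I + π / 2 * errDeriv 1 z) * I +
        I / 2 * partialY (errDeriv 0) z := by
    have h1 := (hG.mul_const I).add (hs1.hasFDerivAt.const_mul (I / 2))
    rw [partialY_congr hY hz, ← partialY_eq hG, partialY, partialY, partialY, hG.fderiv]
    refine (congrArg (fun L : ℂ →L[ℝ] ℂ => L I) h1.fderiv).trans ?_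
    simp
    ring
  have hy : (z.im : ℂ) ≠ 0 := by exact_mod_cast hz.ne'
  rw [laplacianAux, partialX_congr hX hz, partialX_eq hG, hYY, hs2, hX z hz, hY z hz]
  field_simp
  ring_nf
  simp only [Complex.I_sq, Complex.I_pow_three]
  ring

/-! ### Transformation behaviour -/

/-- A family `F a b` of functions on the upper half-plane, indexed by row vectors `(a, b)`, whose
members are permuted in weight `k` by `S` and `T`, is permuted by the whole modular group. -/
theorem permuted_of_generators {F : ℝ → ℝ → UpperHalfPlane → ℂ} {k : ℤ}
    (hS : ∀ a b τ, F a b (ModularGroup.S • τ) = (τ : ℂ) ^ k * F b (-a) τ)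
    (hT : ∀ a b τ, F a b (ModularGroup.T • τ) = F a (a + b) τ) (γ : SL(2, ℤ)) (a b : ℝ)
    (τ : UpperHalfPlane) :
    F a b (γ • τ) = lin γ τ ^ k *
      F (a * (γ 0 0 : ℤ) + b * (γ 1 0 : ℤ)) (a * (γ 0 1 : ℤ) + b * (γ 1 1 : ℤ)) τ := by
  have key : γ ∈ Subgroup.closure {ModularGroup.S, ModularGroup.T} := by
    simp [SpecialLinearGroup.SL2Z_generators]
  induction key using Subgroup.closure_induction generalizing a b τ with
  | mem x hx =>
    rcases hx with rfl | rfl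
    · rw [hS]; simp [lin, ModularGroup.S]
    · rw [hT]; simp [lin, ModularGroup.T]
  | one => simp [lin]
  | mul x y _ _ hx hy =>
    rw [mul_smul, hx, hy, lin_mul, mul_zpow, mul_assoc]
    simp only [Matrix.SpecialLinearGroup.coe_mul, Matrix.mul_apply, Fin.sum_univ_two]
    push_cast
    ring_nf
  | inv x _ hx =>
    have h1 : lin x (x⁻¹ • τ) * lin x⁻¹ τ = 1 := by
      rw [← lin_mul, mul_inv_cancel]; simp [lin]
    have hdet : ((x 0 0 : ℤ) : ℝ) * (x 1 1 : ℤ) - (x 0 1 : ℤ) * (x 1 0 : ℤ) = 1 := by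
      have := x.det_coe
      rw [Matrix.det_fin_two] at this
      exact_mod_cast this
    have h2 := hx (a * (x 1 1 : ℤ) - b * (x 1 0 : ℤ)) (-a * (x 0 1 : ℤ) + b * (x 0 0 : ℤ))
      (x⁻¹ • τ)
    rw [smul_inv_smul] at h2
    have ha : (a * (x 1 1 : ℤ) - b * (x 1 0 : ℤ)) * (x 0 0 : ℤ) +
        (-a * (x 0 1 : ℤ) + b * (x 0 0 : ℤ)) * (x 1 0 : ℤ) = a := by
      linear_combination a * hdet
    have hb : (a * (x 1 1 : ℤ) - b * (x 1 0 : ℤ)) * (x 0 1 : ℤ) +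
        (-a * (x 0 1 : ℤ) + b * (x 0 0 : ℤ)) * (x 1 1 : ℤ) = b := by
      linear_combination b * hdet
    rw [ha, hb] at h2
    have e : F a b (x⁻¹ • τ) = lin x⁻¹ τ ^ k *
        F (a * (x 1 1 : ℤ) - b * (x 1 0 : ℤ)) (-a * (x 0 1 : ℤ) + b * (x 0 0 : ℤ)) τ := by
      rw [h2, ← mul_assoc, ← mul_zpow, mul_comm (lin x⁻¹ τ), h1, one_zpow, one_mul]
    rw [e]
    have c00 : (x⁻¹ : SL(2, ℤ)) 0 0 = x 1 1 := by simp [Matrix.SpecialLinearGroup.SL2_inv_expl]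
    have c01 : (x⁻¹ : SL(2, ℤ)) 0 1 = -x 0 1 := by simp [Matrix.SpecialLinearGroup.SL2_inv_expl]
    have c10 : (x⁻¹ : SL(2, ℤ)) 1 0 = -x 1 0 := by simp [Matrix.SpecialLinearGroup.SL2_inv_expl]
    have c11 : (x⁻¹ : SL(2, ℤ)) 1 1 = x 0 0 := by simp [Matrix.SpecialLinearGroup.SL2_inv_expl]
    rw [c00, c01, c10, c11]
    push_cast
    ring_nf

/-- The family of functions `L / θ · η³`, of weight two, indexed by characteristics `(a, b)`. At
`(0, 1/2)` it is a multiple of `h₁ η³`. -/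
def weightTwo (a b : ℝ) (τ : UpperHalfPlane) : ℂ :=
  latticeSum a b τ / thetaChar a b τ * ModularForm.eta (τ : ℂ) ^ 3

lemma weightTwo_smul (γ : SL(2, ℤ)) (a b : ℝ) (τ : UpperHalfPlane) :
    weightTwo a b (γ • τ) = lin γ τ ^ (2 : ℤ) * weightTwo (a * (γ 0 0 : ℤ) + b * (γ 1 0 : ℤ))
      (a * (γ 0 1 : ℤ) + b * (γ 1 1 : ℤ)) τ := by
  refine permuted_of_generators (fun a b τ => ?_) (fun a b τ => ?_) γ a b τ
  · have hτ : (τ : ℂ) ≠ 0 := UpperHalfPlane.ne_zero τ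
    have hc : (-I * (τ : ℂ)) ^ (1 / 2 : ℂ) ≠ 0 := by simp [Complex.cpow_eq_zero_iff, hτ]
    have hsq : ((-I * (τ : ℂ)) ^ (1 / 2 : ℂ)) ^ 2 = -I * τ := by
      rw [← Complex.cpow_nat_mul]; norm_num
    have hI : (-I : ℂ) ≠ 0 := neg_ne_zero.2 I_ne_zero
    rw [weightTwo, weightTwo, latticeSum_S_smul, thetaChar_S_smul, eta_S_smul, mul_div_mul_comm,
      mul_pow, pow_succ ((-I * (τ : ℂ)) ^ (1 / 2 : ℂ)), hsq]
    generalize (-I * (τ : ℂ)) ^ (1 / 2 : ℂ) = c at hc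
    generalize latticeSum b (-a) τ / thetaChar b (-a) τ = Q
    field_simp
  · have he := Complex.exp_ne_zero (π * I / 4)
    rw [weightTwo, weightTwo, latticeSum_T_smul, thetaChar_T_smul, eta_T_smul_pow_three]
    field_simp

lemma latticeSum_div_thetaChar_add_int (a b : ℝ) (m n : ℤ) (z : ℂ) :
    latticeSum (a + m) (b + n) z / thetaChar (a + m) (b + n) z =
      latticeSum a b z / thetaChar a b z := by
  rw [latticeSum_add_int, thetaChar_add_int, mul_div_mul_left]
  exact mul_ne_zero (zpow_ne_zero _ (by norm_num)) (Complex.exp_ne_zero _)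

lemma h1_eq_weightTwo (τ : UpperHalfPlane) :
    h1 τ = I / (2 * π) * (weightTwo 0 (1 / 2) τ / ModularForm.eta (τ : ℂ) ^ 3) := by
  rw [h1_eq, weightTwo, mul_div_cancel_right₀ _ (pow_ne_zero 3 (eta_coe_ne_zero τ))]

/-- Under the full modular group `h₁` is carried to the quotients of lattice sum and theta function
at the characteristics `(c/2, d/2)`; this gives both the transformation law on `Γ₀(2)` and the
behaviour at all cusps. -/
lemma h1_smul (γ : SL(2, ℤ)) (τ : UpperHalfPlane) :
    h1 (γ • τ) = etaMultiplier γ ^ (-3 : ℤ) * autFactor 1 γ τ * (I / (2 * π) *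
      (latticeSum ((γ 1 0 : ℤ) / 2) ((γ 1 1 : ℤ) / 2) τ /
        thetaChar ((γ 1 0 : ℤ) / 2) ((γ 1 1 : ℤ) / 2) τ)) := by
  have h1 := eta_coe_ne_zero τ
  have h2 := eta_coe_ne_zero (γ • τ)
  have e0 : (0 : ℝ) * (γ 0 0 : ℤ) + 1 / 2 * (γ 1 0 : ℤ) = (γ 1 0 : ℤ) / 2 := by ring
  have e1 : (0 : ℝ) * (γ 0 1 : ℤ) + 1 / 2 * (γ 1 1 : ℤ) = (γ 1 1 : ℤ) / 2 := by ring
  rw [h1_eq_weightTwo, weightTwo_smul, e0, e1, etaMultiplier_mul_autFactor, weightTwo]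
  generalize latticeSum ((γ 1 0 : ℤ) / 2) ((γ 1 1 : ℤ) / 2) τ /
        thetaChar ((γ 1 0 : ℤ) / 2) ((γ 1 1 : ℤ) / 2) τ = Q
  rw [div_pow]
  norm_cast
  ring

lemma h1_smul_of_mem_Gamma0 {γ : SL(2, ℤ)} (hγ : γ ∈ CongruenceSubgroup.Gamma0 2)
    (τ : UpperHalfPlane) :
    h1 (γ • τ) = etaMultiplier γ ^ (-3 : ℤ) * autFactor 1 γ τ * h1 τ := by
  have hc : Even (γ 1 0) := by
    rw [CongruenceSubgroup.Gamma0_mem] at hγ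
    exact even_iff_two_dvd.2 ((ZMod.intCast_zmod_eq_zero_iff_dvd _ 2).1 hγ)
  have hd : Odd (γ 1 1) := by
    by_contra h
    rw [Int.not_odd_iff_even] at h
    have hdet := γ.det_coe
    rw [Matrix.det_fin_two] at hdet
    have := (h.mul_left (γ 0 0)).sub (hc.mul_left (γ 0 1))
    rw [hdet] at this
    exact absurd this (by decide)
  -- `(0, 1/2) γ = (c/2, d/2)` and `(0, 1/2)` differ by the integral vector `(m, n)`
  obtain ⟨m, hm⟩ := hc
  obtain ⟨n, hn⟩ := hd
  have e0 : ((γ 1 0 : ℤ) : ℝ) / 2 = 0 + (m : ℤ) := by rw [hm]; push_cast; ring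
  have e1 : ((γ 1 1 : ℤ) : ℝ) / 2 = 1 / 2 + (n : ℤ) := by rw [hn]; push_cast; ring
  rw [h1_smul, e0, e1, latticeSum_div_thetaChar_add_int, h1_eq]

/-! ### Growth at the cusps -/

lemma inv_thetaChar_zero_half_isBigO :
    (fun τ : UpperHalfPlane => (thetaChar 0 (1 / 2) τ)⁻¹) =O[UpperHalfPlane.atImInfty]
      fun τ : UpperHalfPlane => Real.exp τ.im := by
  have h := (tendsto_exp_mul_thetaChar_zero_half.inv₀ (by norm_num)).isBigO_one ℝ
  have he : (fun τ : UpperHalfPlane => cexp (-(π * I * τ / 4))) =O[UpperHalfPlane.atImInfty]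
      fun τ : UpperHalfPlane => Real.exp τ.im := by
    refine Asymptotics.isBigO_of_le _ fun τ => ?_
    rw [Complex.norm_exp, Real.norm_of_nonneg (Real.exp_pos _).le]
    refine Real.exp_le_exp.2 ?_
    have e : (-(π * I * τ / 4) : ℂ) = ((-π / 4 : ℝ) : ℂ) * (I * τ) := by push_cast; ring
    rw [e, Complex.re_ofReal_mul]
    simp
    nlinarith [Real.pi_lt_four, τ.im_pos]
  refine (he.mul h).congr (fun τ => ?_) fun τ => mul_one _
  rw [mul_inv, mul_inv_cancel_left₀ (Complex.exp_ne_zero _)]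

lemma inv_thetaChar_half_isBigO (b : ℝ) :
    (fun τ : UpperHalfPlane => (thetaChar (1 / 2) b τ)⁻¹) =O[UpperHalfPlane.atImInfty]
      fun τ : UpperHalfPlane => Real.exp τ.im := by
  refine ((tendsto_thetaChar_half.inv₀ (Complex.exp_ne_zero _)).isBigO_one ℝ).trans ?_
  refine Asymptotics.isBigO_of_le _ fun τ => ?_
  rw [norm_one, Real.norm_of_nonneg (Real.exp_pos _).le]
  exact Real.one_le_exp τ.im_pos.le

lemma latticeSum_isBigO (p r : ℤ) :
    (fun τ : UpperHalfPlane => latticeSum (p / 2) (r / 2) τ) =O[UpperHalfPlane.atImInfty]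
      fun τ : UpperHalfPlane => Real.exp τ.im := by
  obtain ⟨B, hB⟩ := exists_norm_latticeSum_le_mul_im
  refine Asymptotics.IsBigO.of_bound |B| ?_
  filter_upwards [(UpperHalfPlane.atImInfty_mem _).2 ⟨1, fun τ h => h⟩] with τ hτ
  rw [Real.norm_of_nonneg (Real.exp_pos _).le]
  refine (hB p r τ hτ).trans ?_
  have h1 : τ.im ≤ Real.exp τ.im := (le_add_of_nonneg_right zero_le_one).trans
    (Real.add_one_le_exp _)
  exact mul_le_mul (le_abs_self B) h1 τ.im_pos.le (abs_nonneg B)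

/-- By periodicity in the characteristic only the three points of order two matter. -/
lemma latticeSum_div_thetaChar_isBigO {p r : ℤ} (h : ¬(Even p ∧ Even r)) :
    (fun τ : UpperHalfPlane => latticeSum (p / 2) (r / 2) τ / thetaChar (p / 2) (r / 2) τ)
      =O[UpperHalfPlane.atImInfty] fun τ : UpperHalfPlane => Real.exp (2 * τ.im) := by
  have hexp : ∀ τ : UpperHalfPlane, Real.exp τ.im * Real.exp τ.im = Real.exp (2 * τ.im) :=
    fun τ => by rw [← Real.exp_add, two_mul]
  have key : ∀ (p₀ r₀ m n : ℤ), p = p₀ + 2 * m → r = r₀ + 2 * n →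
      ((fun τ : UpperHalfPlane => (thetaChar (p₀ / 2) (r₀ / 2) τ)⁻¹) =O[UpperHalfPlane.atImInfty]
        fun τ : UpperHalfPlane => Real.exp τ.im) →
      (fun τ : UpperHalfPlane => latticeSum (p / 2) (r / 2) τ / thetaChar (p / 2) (r / 2) τ)
        =O[UpperHalfPlane.atImInfty] fun τ : UpperHalfPlane => Real.exp (2 * τ.im) := by
    intro p₀ r₀ m n hp hr h0
    have e0 : (p : ℝ) / 2 = p₀ / 2 + m := by rw [hp]; push_cast; ring
    have e1 : (r : ℝ) / 2 = r₀ / 2 + n := by rw [hr]; push_cast; ring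
    simp only [e0, e1, latticeSum_div_thetaChar_add_int]
    exact ((latticeSum_isBigO p₀ r₀).mul h0).congr (fun τ => (div_eq_mul_inv _ _).symm) hexp
  rcases Int.even_or_odd' p with ⟨m, hm | hm⟩ <;> rcases Int.even_or_odd' r with ⟨n, hn | hn⟩
  · exact absurd ⟨⟨m, by omega⟩, ⟨n, by omega⟩⟩ h
  · exact key 0 1 m n (by omega) (by omega) (by simpa using inv_thetaChar_zero_half_isBigO)
  · exact key 1 0 m n (by omega) (by omega) (by simpa using inv_thetaChar_half_isBigO 0)
  · exact key 1 1 m n (by omega) (by omega) (by simpa using inv_thetaChar_half_isBigO (1 / 2))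

lemma hasLinearExpGrowthAtCusps_h1 : HasLinearExpGrowthAtCusps 1 h1 := by
  intro M
  refine ⟨2, ?_⟩
  have hM : ¬(Even (M 1 0) ∧ Even (M 1 1)) := fun ⟨hc, hd⟩ => by
    have hdet := M.det_coe
    rw [Matrix.det_fin_two] at hdet
    have := (hd.mul_left (M 0 0)).sub (hc.mul_left (M 0 1))
    rw [hdet] at this
    exact absurd this (by decide)
  refine ((latticeSum_div_thetaChar_isBigO hM).const_mul_left
    (etaMultiplier M ^ (-3 : ℤ) * (I / (2 * π)))).congr_left fun τ => ?_
  have h0 := autFactor_one_ne_zero M τ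
  rw [h1_smul]
  field_simp

end HarmonicMaass

end

theorem mainTheorem4 :
    HarmonicMaass.IsHarmonicWeakMaassForm 1 (CongruenceSubgroup.Gamma0 2)
      (fun γ => HarmonicMaass.etaMultiplier γ ^ (-3 : ℤ)) HarmonicMaass.h1 where
  congruence := CongruenceSubgroup.Gamma0_is_congruence 2
  multiplier := HarmonicMaass.isMultiplierSystem_etaMultiplier _
  transform _ hγ τ := HarmonicMaass.h1_smul_of_mem_Gamma0 hγ τ
  smooth := HarmonicMaass.contDiffOn_h1
  harmonic := HarmonicMaass.hypLaplacian_h1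
  growth := HarmonicMaass.hasLinearExpGrowthAtCusps_h1
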